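/- Let $n$ be a non-negative integer, let $1<p<\infty$ and $\frac1p+\frac1{p'}=1$. For complex-valued $h$ on $\mathbb R^n$ write $|\nabla h|=\big(\sum_{j}|\partial_j h|^2\big)^{1/2}$, and for a Schwartz function $g$ let $(-\Delta)^{r}g$ be the function whose Fourier transform is $(4\pi^2|\xi|^2)^{r}\hat g(\xi)$, where $\hat g(\xi)=\int e^{-2\pi i x\cdot\xi}g(x)\,dx$. (a) Let $\lambda,\alpha,\beta,\sigma\in\mathbb R$ satisfy $0<\lambda<n$, $\alpha<n/p$, $1-n/p<\beta<n/p'$, $\beta+\sigma-1<n/p'$ and $n+1=\lambda+\alpha+\beta+\sigma$. Then for every $f\in\mathcal S(\mathbb R^n)$ the convolution $|x|^{-\lambda}*(|x|^{-\sigma}f)$ exists (as an absolutely convergent integral) at almost every point, and $$\big\||x|^{-\alpha}\big(|x|^{-\lambda}*(|x|^{-\sigma}f)\big)\big\|_{L^p(\mathbb R^n)}\le F_{\alpha,\beta,\sigma}\,\big\||x|^{\beta}\nabla f\big\|_{L^p(\mathbb R^n)},$$ $$F_{\alpha,\beta,\sigma}=\pi^{n/2}\Big(\frac np+\beta-1\Big)^{-1}\,\frac{\Gamma\big(\frac{\alpha+\beta+\sigma-1}2\big)\,\Gamma\big(\frac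 n{2p}-\frac\alpha2\big)\,\Gamma\big(\frac n{2p'}-\frac{\beta+\sigma-1}2\big)}{\Gamma\big(\frac{n+1-\alpha-\beta-\sigma}2\big)\,\Gamma\big(\frac n{2p'}+\frac\alpha2\big)\,\Gamma\big(\frac n{2p}+\frac{\beta+\sigma-1}2\big)};$$ and for every $g\in\mathcal S(\mathbb R^n)$ $$\big\||x|^{-\alpha}g\big\|_{L^p(\mathbb R^n)}\le\frac{2^{-(\alpha+\beta+\sigma-1)}}{\frac np+\beta-1}\,\frac{\Gamma\big(\frac n{2p}-\frac\alpha2\big)\,\Gamma\big(\frac n{2p'}-\frac{\beta+\sigma-1}2\big)}{\Gamma\big(\frac n{2p'}+\frac\alpha2\big)\,\Gamma\big(\frac n{2p}+\frac{\beta+\sigma-1}2\big)}\,\big\||x|^{\beta}\,\nabla\big(|x|^{\sigma}(-\Delta)^{(\alpha+\beta+\sigma-1)/2}g\big)\big\|_{L^p(\mathbb R^n)} .$$ (b) (Davies–Hinz inequality.) Let $m\ge0$ be an integer and let $\gamma\in\mathbb R$ satisfy $\gamma+(2m+1)p<n$ and $\gamma>-n(p-1)$. Then for every $u\in\mathcal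 S(\mathbb R^n)$ $$\int_{\mathbb R^n}|x|^{-\gamma}|\nabla\Delta^m u|^p\,dx\ \ge\ B_{\gamma,m}^{-1}\int_{\mathbb R^n}|x|^{-\gamma-(2m+1)p}|u|^p\,dx,$$ $$B_{\gamma,m}=2^{-(2m+1)p}\left[\frac{\Gamma\big(\frac{n-\gamma}{2p}-m-\frac12\big)\,\Gamma\big(\frac n{2p'}+\frac\gamma{2p}+\frac12\big)}{\Gamma\big(\frac n{2p'}+\frac\gamma{2p}+m+\frac12\big)\,\Gamma\big(\frac{n-\gamma}{2p}+\frac12\big)}\right]^p .$$ -/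

import Mathlib

open MeasureTheory
open scoped SchwartzMap FourierTransform Convolution

noncomputable section

/-- The Euclidean length `|∇f(x)| = (∑ⱼ |∂ⱼ f(x)|²)^{1/2}` of the gradient of a complex-valued
function on `ℝⁿ`. -/
def gradNorm {n : ℕ} (f : EuclideanSpace ℝ (Fin n) → ℂ) (x : EuclideanSpace ℝ (Fin n)) : ℝ :=
  Real.sqrt (∑ j : Fin n, ‖fderiv ℝ f x (EuclideanSpace.single j 1)‖ ^ 2)

/-- The power `(-Δ)^r` of the Laplacian on `ℝⁿ`, acting on a Schwartz function: multiplication of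
the Fourier transform by `(4π²|ξ|²)^r` (the Fourier transform has kernel `e^{-2πi⟨x, ξ⟩}`). -/
def fracLaplacian {n : ℕ} (r : ℝ) (g : 𝓢(EuclideanSpace ℝ (Fin n), ℂ)) :
    EuclideanSpace ℝ (Fin n) → ℂ :=
  𝓕⁻ (fun ξ : EuclideanSpace ℝ (Fin n) =>
    (((4 * Real.pi ^ 2 * ‖ξ‖ ^ 2) ^ r : ℝ) : ℂ) * 𝓕 (g : EuclideanSpace ℝ (Fin n) → ℂ) ξ)

/-- The power weight `|x|^a` on `ℝⁿ`. -/
def powWeight {n : ℕ} (a : ℝ) (x : EuclideanSpace ℝ (Fin n)) : ℝ := ‖x‖ ^ a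

/-- The constant in the Stein-Weiss potential estimate with gradient; `q` is the exponent dual
to `p`. -/
def steinWeissGradConst (n : ℕ) (p q α β σ : ℝ) : ℝ :=
  Real.pi ^ ((n : ℝ) / 2) * ((n : ℝ) / p + β - 1)⁻¹ *
    ((Real.Gamma ((α + β + σ - 1) / 2) * Real.Gamma (n / (2 * p) - α / 2) *
        Real.Gamma (n / (2 * q) - (β + σ - 1) / 2)) /
      (Real.Gamma ((n + 1 - α - β - σ) / 2) * Real.Gamma (n / (2 * q) + α / 2) *
        Real.Gamma (n / (2 * p) + (β + σ - 1) / 2)))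

/-- The constant in the Hardy-Rellich estimate with gradient; `q` is the exponent dual to `p`. -/
def hardyRellichGradConst (n : ℕ) (p q α β σ : ℝ) : ℝ :=
  (2 : ℝ) ^ (-(α + β + σ - 1)) / ((n : ℝ) / p + β - 1) *
    ((Real.Gamma (n / (2 * p) - α / 2) * Real.Gamma (n / (2 * q) - (β + σ - 1) / 2)) /
      (Real.Gamma (n / (2 * q) + α / 2) * Real.Gamma (n / (2 * p) + (β + σ - 1) / 2)))

/-- The constant in the Davies-Hinz inequality for `∇Δ^m`, so that
`∫ |x|^{-γ-(2m+1)p} |u|^p` is at most this constant times `∫ |x|^{-γ} |∇Δ^m u|^p`;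
`q` is the exponent dual to `p`. -/
def daviesHinzConst (n : ℕ) (p q γ : ℝ) (m : ℕ) : ℝ :=
  (2 : ℝ) ^ (-(2 * m + 1) * p) *
    ((Real.Gamma ((n - γ) / (2 * p) - m - 1 / 2) *
        Real.Gamma (n / (2 * q) + γ / (2 * p) + 1 / 2)) /
      (Real.Gamma (n / (2 * q) + γ / (2 * p) + m + 1 / 2) *
        Real.Gamma ((n - γ) / (2 * p) + 1 / 2))) ^ p

end

/-!
The potential estimate combines two one-step inequalities, both obtained with their sharp constants.

* The Stein-Weiss inequality `lintegral_steinWeiss_le` is Schur's test for the kernel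
  `|x|^{-α} |x - y|^{-λ} |y|^{-b}`, homogeneous of degree `-n`, with the weights `|x|^{-n/(pq)}`. Both
  conditions of the test reduce to the composition formula `|x|^{-a} * |x|^{-b} = C |x|^{n-a-b}`
  (`lintegral_norm_sub_rpow_mul_norm_rpow`), which gives the Gamma factors. That formula is proved by
  writing powers as superpositions of Gaussians.
* The Hardy inequality `lintegral_hardy_le`, with constant `(n/p + β - 1)⁻¹`, follows from
  `|f(x)| ≤ ∫_1^∞ |x| |∇f(t x)| dt`, Hölder's inequality in `t` with the right power of `t`, and
  scaling. Only a weak form of decay along almost every ray is needed.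

With `b = β + σ - 1` and the density `|x|^{β-1} f` this is the estimate with gradient for Schwartz `f`.

For the Hardy-Rellich estimate let `F = (-Δ)^r g` with `2r = n - λ`. Superposing heat semigroups
shows that `|g|` is at most the Riesz potential of `|F|` (`enorm_le_lintegral_fracLaplacian`), so the
same two inequalities are applied to `f = |x|^σ F`. This function is not Schwartz: it is singular at
the origin and decays slowly. It suffices for the Hardy inequality that `σ < n` and that `F` is
integrable (`lintegral_enorm_fracLaplacian_lt_top`); the latter comes from decomposing the symbol
`|ξ|^{2r}` into dilates of a smooth compactly supported multiplier.

The Davies-Hinz inequality is the case `σ = 0`, `r = m` of the Hardy-Rellich estimate if `m ≥ 1`, and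
the Hardy inequality itself if `m = 0`; the constants agree by `Γ(z + 1) = z Γ(z)`.
-/

open Set Filter Topology
open scoped ENNReal

local notation "𝔼" n:max => EuclideanSpace ℝ (Fin n)

/-! ### Gamma and Gaussian integrals -/

theorem lintegral_rpow_mul_exp_neg_mul_Ioi {c k : ℝ} (hc : 0 < c) (hk : 0 < k) :
    ∫⁻ t in Ioi (0 : ℝ), ENNReal.ofReal (t ^ (c - 1) * Real.exp (-(k * t))) =
      ENNReal.ofReal (Real.Gamma c * k ^ (-c)) := by
  have h1 := Real.integral_rpow_mul_exp_neg_mul_Ioi hc hk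
  have h2 : IntegrableOn (fun t : ℝ => t ^ (c - 1) * Real.exp (-(k * t))) (Ioi 0) := by
    have := integrableOn_rpow_mul_exp_neg_mul_rpow (p := 1) (s := c - 1) (b := k) (by linarith)
      one_pos hk
    simpa [neg_mul] using this
  rw [← ofReal_integral_eq_lintegral_ofReal h2, h1, mul_comm, one_div,
    Real.inv_rpow hk.le, Real.rpow_neg hk.le]
  filter_upwards [ae_restrict_mem measurableSet_Ioi] with t ht
  have : (0 : ℝ) < t := ht
  positivity

theorem lintegral_exp_neg_mul_norm_sub_sq {n : ℕ} {b : ℝ} (hb : 0 < b) (x : 𝔼 n) :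
    ∫⁻ y : 𝔼 n, ENNReal.ofReal (Real.exp (-b * ‖y - x‖ ^ 2)) =
      ENNReal.ofReal ((Real.pi / b) ^ ((n : ℝ) / 2)) := by
  rw [lintegral_sub_right_eq_self (fun y : 𝔼 n => ENNReal.ofReal (Real.exp (-b * ‖y‖ ^ 2))) x]
  have h := GaussianFourier.integral_rexp_neg_mul_sq_norm (V := 𝔼 n) hb
  rw [finrank_euclideanSpace_fin] at h
  have hi : Integrable (fun y : 𝔼 n => Real.exp (-b * ‖y‖ ^ 2)) := by
    by_contra hc
    rw [integral_undef hc] at h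
    have : 0 < (Real.pi / b) ^ ((n : ℝ) / 2) := by positivity
    linarith
  rw [← ofReal_integral_eq_lintegral_ofReal hi (Eventually.of_forall fun _ => (Real.exp_pos _).le), h]

theorem lintegral_exp_neg_mul_norm_sq_mul {n : ℕ} {s t : ℝ} (hs : 0 < s) (ht : 0 < t) (x : 𝔼 n) :
    ∫⁻ y : 𝔼 n, ENNReal.ofReal (Real.exp (-(s * ‖x - y‖ ^ 2)) * Real.exp (-(t * ‖y‖ ^ 2))) =
      ENNReal.ofReal ((Real.pi / (s + t)) ^ ((n : ℝ) / 2) *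
        Real.exp (-(s * t / (s + t) * ‖x‖ ^ 2))) := by
  have hst : 0 < s + t := by positivity
  -- complete the square around the weighted mean `s x / (s + t)`
  have key : ∀ y : 𝔼 n, Real.exp (-(s * ‖x - y‖ ^ 2)) * Real.exp (-(t * ‖y‖ ^ 2)) =
      Real.exp (-(s + t) * ‖y - (s / (s + t)) • x‖ ^ 2) *
        Real.exp (-(s * t / (s + t) * ‖x‖ ^ 2)) := by
    intro y
    rw [← Real.exp_add, ← Real.exp_add]
    congr 1
    rw [norm_sub_sq_real, norm_sub_sq_real, norm_smul, inner_smul_right, real_inner_comm y x,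
      Real.norm_of_nonneg (by positivity : 0 ≤ s / (s + t))]
    field_simp
    ring
  simp_rw [key]
  have : ∀ y : 𝔼 n, ENNReal.ofReal (Real.exp (-(s + t) * ‖y - (s / (s + t)) • x‖ ^ 2) *
        Real.exp (-(s * t / (s + t) * ‖x‖ ^ 2))) =
      ENNReal.ofReal (Real.exp (-(s + t) * ‖y - (s / (s + t)) • x‖ ^ 2)) *
        ENNReal.ofReal (Real.exp (-(s * t / (s + t) * ‖x‖ ^ 2))) :=
    fun y => ENNReal.ofReal_mul (Real.exp_pos _).le
  simp_rw [this]
  rw [lintegral_mul_const _ (by fun_prop), lintegral_exp_neg_mul_norm_sub_sq hst,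
    ENNReal.ofReal_mul (by positivity)]

theorem lintegral_comp_smul {n : ℕ} (f : 𝔼 n → ℝ≥0∞) {t : ℝ} (ht : 0 < t) :
    ∫⁻ x, f (t • x) = ENNReal.ofReal (t ^ (-(n : ℝ))) * ∫⁻ x, f x := by
  have h := Measure.map_addHaar_smul (volume : Measure (𝔼 n)) ht.ne'
  have h2 : ∫⁻ x, f x ∂(Measure.map (fun x : 𝔼 n => t • x) volume) = ∫⁻ x, f (t • x) :=
    (Homeomorph.smulOfNeZero t ht.ne').toMeasurableEquiv.measurableEmbedding.lintegral_map f
  rw [← h2, h, lintegral_smul_measure, finrank_euclideanSpace_fin, abs_of_pos (by positivity),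
    Real.rpow_neg ht.le, Real.rpow_natCast, smul_eq_mul]

theorem lintegral_Ioi_comp_mul (f : ℝ → ℝ≥0∞) {s : ℝ} (hs : 0 < s) :
    ENNReal.ofReal s * ∫⁻ t in Ioi (0 : ℝ), f (s * t) = ∫⁻ t in Ioi (0 : ℝ), f t := by
  have h := Real.smul_map_volume_mul_left hs.ne'
  have hme : MeasurableEmbedding (fun t : ℝ => s * t) :=
    (Homeomorph.mulLeft₀ s hs.ne').toMeasurableEquiv.measurableEmbedding
  conv_rhs => rw [← h]
  rw [Measure.restrict_smul, lintegral_smul_measure, hme.restrict_map, hme.lintegral_map,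
    abs_of_pos hs]
  congr 3
  ext t
  simp [mul_pos_iff_of_pos_left hs]

theorem ofReal_norm_rpow_eq_lintegral {n : ℕ} {a : ℝ} (ha : 0 < a) {x : 𝔼 n} (hx : x ≠ 0) :
    ENNReal.ofReal (Real.Gamma (a / 2) * ‖x‖ ^ (-a)) =
      ∫⁻ t in Ioi (0 : ℝ), ENNReal.ofReal (t ^ (a / 2 - 1) * Real.exp (-(t * ‖x‖ ^ 2))) := by
  have hx' : 0 < ‖x‖ := norm_pos_iff.2 hx
  have := lintegral_rpow_mul_exp_neg_mul_Ioi (c := a / 2) (k := ‖x‖ ^ 2) (by positivity)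
    (by positivity)
  rw [show -a = (2 : ℕ) * (-(a / 2)) by push_cast; ring, Real.rpow_natCast_mul hx'.le, ← this]
  simp_rw [mul_comm (‖x‖ ^ 2)]

/-! ### The Riesz composition formula -/

/-- Euler's Beta integral over the half line. -/
theorem lintegral_rpow_mul_one_add_rpow {A B : ℝ} (hA : 0 < A) (hB : 0 < B) :
    ∫⁻ τ in Ioi (0 : ℝ), ENNReal.ofReal (τ ^ (B - 1) * (1 + τ) ^ (-(A + B))) =
      ENNReal.ofReal (Real.Gamma A * Real.Gamma B / Real.Gamma (A + B)) := by
  have hG : 0 < Real.Gamma (A + B) := Real.Gamma_pos_of_pos (by positivity)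
  have hAB : 0 < A + B := by positivity
  have key : ENNReal.ofReal (Real.Gamma (A + B)) *
      ∫⁻ τ in Ioi (0 : ℝ), ENNReal.ofReal (τ ^ (B - 1) * (1 + τ) ^ (-(A + B))) =
      ENNReal.ofReal (Real.Gamma B * Real.Gamma A) := by
    calc _ = ∫⁻ τ in Ioi (0 : ℝ), ∫⁻ ρ in Ioi (0 : ℝ),
          ENNReal.ofReal (τ ^ (B - 1)) *
            ENNReal.ofReal (ρ ^ (A + B - 1) * Real.exp (-((1 + τ) * ρ))) := by
          rw [← lintegral_const_mul _ (by fun_prop)]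
          refine setLIntegral_congr_fun measurableSet_Ioi fun τ hτ => ?_
          have hτ' : (0 : ℝ) < τ := hτ
          rw [lintegral_const_mul _ (by fun_prop),
            lintegral_rpow_mul_exp_neg_mul_Ioi hAB (by positivity : 0 < 1 + τ),
            ← ENNReal.ofReal_mul hG.le, ← ENNReal.ofReal_mul (by positivity)]
          congr 1; ring
      _ = ∫⁻ ρ in Ioi (0 : ℝ), ∫⁻ τ in Ioi (0 : ℝ),
          ENNReal.ofReal (τ ^ (B - 1)) *
            ENNReal.ofReal (ρ ^ (A + B - 1) * Real.exp (-((1 + τ) * ρ))) :=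
          lintegral_lintegral_swap (by fun_prop)
      _ = ∫⁻ ρ in Ioi (0 : ℝ), ENNReal.ofReal (Real.Gamma B) *
            ENNReal.ofReal (ρ ^ (A - 1) * Real.exp (-(1 * ρ))) := by
          refine setLIntegral_congr_fun measurableSet_Ioi fun ρ hρ => ?_
          have hρ' : (0 : ℝ) < ρ := hρ
          have : ∀ τ ∈ Ioi (0 : ℝ), ENNReal.ofReal (τ ^ (B - 1)) *
              ENNReal.ofReal (ρ ^ (A + B - 1) * Real.exp (-((1 + τ) * ρ))) =
              ENNReal.ofReal (ρ ^ (A + B - 1) * Real.exp (-(1 * ρ))) *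
              ENNReal.ofReal (τ ^ (B - 1) * Real.exp (-(ρ * τ))) := by
            intro τ hτ
            have hτ' : (0 : ℝ) < τ := hτ
            rw [← ENNReal.ofReal_mul (by positivity), ← ENNReal.ofReal_mul (by positivity)]
            rw [show -((1 + τ) * ρ) = -(1 * ρ) + -(ρ * τ) by ring, Real.exp_add]
            congr 1; ring
          rw [setLIntegral_congr_fun measurableSet_Ioi this, lintegral_const_mul _ (by fun_prop),
            lintegral_rpow_mul_exp_neg_mul_Ioi hB hρ', ← ENNReal.ofReal_mul (by positivity),
            ← ENNReal.ofReal_mul (Real.Gamma_pos_of_pos hB).le]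
          congr 1
          rw [show A + B - 1 = (A - 1) + B by ring, Real.rpow_add hρ', Real.rpow_neg hρ'.le]
          field_simp
      _ = _ := by
          rw [lintegral_const_mul _ (by fun_prop), lintegral_rpow_mul_exp_neg_mul_Ioi hA one_pos,
            ← ENNReal.ofReal_mul (Real.Gamma_pos_of_pos hB).le]
          simp
  rw [mul_comm (Real.Gamma A), ENNReal.ofReal_div_of_pos hG, ← key,
    ENNReal.mul_div_right_comm, ENNReal.div_self (by simpa using hG) ENNReal.ofReal_ne_top, one_mul]

/-- The constant in the composition formula `|x|^{-a} * |x|^{-b} = C |x|^{n-a-b}` on `ℝⁿ`. -/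
noncomputable def rieszCompositionConst (n : ℕ) (a b : ℝ) : ℝ :=
  Real.pi ^ ((n : ℝ) / 2) *
    (Real.Gamma ((n - a) / 2) * Real.Gamma ((n - b) / 2) * Real.Gamma ((a + b - n) / 2) /
      (Real.Gamma (a / 2) * Real.Gamma (b / 2) * Real.Gamma ((2 * n - a - b) / 2)))

/-- Representing both powers as superpositions of Gaussians reduces the formula to Gaussian
convolutions and, after the substitution `t = s τ`, to a Beta integral. -/
theorem lintegral_norm_sub_rpow_mul_norm_rpow {n : ℕ} {a b : ℝ} (ha : 0 < a) (han : a < n)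
    (hb : 0 < b) (hbn : b < n) (hab : n < a + b) {x : 𝔼 n} (hx : x ≠ 0) :
    ∫⁻ y : 𝔼 n, ENNReal.ofReal (‖x - y‖ ^ (-a) * ‖y‖ ^ (-b)) =
      ENNReal.ofReal (rieszCompositionConst n a b * ‖x‖ ^ (n - a - b)) := by
  have : Nontrivial (𝔼 n) := ⟨⟨x, 0, hx⟩⟩
  have hx' : 0 < ‖x‖ := norm_pos_iff.2 hx
  have hGa := Real.Gamma_pos_of_pos (s := a / 2) (by linarith)
  have hGb := Real.Gamma_pos_of_pos (s := b / 2) (by linarith)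
  have hGab : 0 < Real.Gamma (a / 2) * Real.Gamma (b / 2) := by positivity
  set c := (a + b - n) / 2 with hc
  have hc0 : 0 < c := by rw [hc]; linarith
  have hGc := Real.Gamma_pos_of_pos hc0
  have key : ENNReal.ofReal (Real.Gamma (a / 2) * Real.Gamma (b / 2)) *
      ∫⁻ y : 𝔼 n, ENNReal.ofReal (‖x - y‖ ^ (-a) * ‖y‖ ^ (-b)) =
      ENNReal.ofReal (Real.pi ^ ((n : ℝ) / 2) * Real.Gamma c * ‖x‖ ^ (-(2 * c))) *
        ENNReal.ofReal (Real.Gamma ((n - b) / 2) * Real.Gamma ((n - a) / 2) /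
          Real.Gamma ((n - b) / 2 + (n - a) / 2)) := by
    calc _ = ∫⁻ y : 𝔼 n, ∫⁻ s in Ioi (0 : ℝ), ∫⁻ t in Ioi (0 : ℝ),
            ENNReal.ofReal (s ^ (a / 2 - 1) * Real.exp (-(s * ‖x - y‖ ^ 2))) *
            ENNReal.ofReal (t ^ (b / 2 - 1) * Real.exp (-(t * ‖y‖ ^ 2))) := by
          rw [← lintegral_const_mul _ (by fun_prop)]
          refine lintegral_congr_ae ?_
          have h0 : ∀ᵐ y : 𝔼 n, y ≠ 0 := by simp [ae_iff]
          have h1 : ∀ᵐ y : 𝔼 n, y ≠ x := by simp [ae_iff]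
          filter_upwards [h0, h1] with y hy0 hyx
          have hxy : x - y ≠ 0 := sub_ne_zero.2 hyx.symm
          simp_rw [lintegral_const_mul _
            (show Measurable fun t => ENNReal.ofReal (t ^ (b / 2 - 1) * Real.exp (-(t * ‖y‖ ^ 2)))
              by fun_prop)]
          rw [lintegral_mul_const _ (by fun_prop), ← ofReal_norm_rpow_eq_lintegral ha hxy,
            ← ofReal_norm_rpow_eq_lintegral hb hy0, ← ENNReal.ofReal_mul (by positivity),
            ← ENNReal.ofReal_mul (by positivity)]
          congr 1; ring
      _ = ∫⁻ s in Ioi (0 : ℝ), ∫⁻ y : 𝔼 n, ∫⁻ t in Ioi (0 : ℝ),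
            ENNReal.ofReal (s ^ (a / 2 - 1) * Real.exp (-(s * ‖x - y‖ ^ 2))) *
            ENNReal.ofReal (t ^ (b / 2 - 1) * Real.exp (-(t * ‖y‖ ^ 2))) := by
          refine lintegral_lintegral_swap (Measurable.aemeasurable ?_)
          exact Measurable.lintegral_prod_right (by fun_prop)
      _ = ∫⁻ s in Ioi (0 : ℝ), ∫⁻ t in Ioi (0 : ℝ), ∫⁻ y : 𝔼 n,
            ENNReal.ofReal (s ^ (a / 2 - 1) * Real.exp (-(s * ‖x - y‖ ^ 2))) *
            ENNReal.ofReal (t ^ (b / 2 - 1) * Real.exp (-(t * ‖y‖ ^ 2))) := by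
          refine lintegral_congr fun s => lintegral_lintegral_swap (by fun_prop)
      _ = ∫⁻ s in Ioi (0 : ℝ), ∫⁻ t in Ioi (0 : ℝ),
            ENNReal.ofReal (s ^ (a / 2 - 1) * t ^ (b / 2 - 1) *
              ((Real.pi / (s + t)) ^ ((n : ℝ) / 2) *
                Real.exp (-(s * t / (s + t) * ‖x‖ ^ 2)))) := by
          refine setLIntegral_congr_fun measurableSet_Ioi fun s hs =>
            setLIntegral_congr_fun measurableSet_Ioi fun t ht => ?_
          have hs' : (0 : ℝ) < s := hs
          have ht' : (0 : ℝ) < t := ht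
          rw [ENNReal.ofReal_mul (by positivity), ← lintegral_exp_neg_mul_norm_sq_mul hs' ht',
            ← lintegral_const_mul _ (by fun_prop)]
          refine lintegral_congr fun y => ?_
          rw [← ENNReal.ofReal_mul (by positivity), ← ENNReal.ofReal_mul (by positivity)]
          congr 1; ring
      _ = ∫⁻ s in Ioi (0 : ℝ), ∫⁻ τ in Ioi (0 : ℝ),
            ENNReal.ofReal (Real.pi ^ ((n : ℝ) / 2) *
              (τ ^ (b / 2 - 1) * (1 + τ) ^ (-((n : ℝ) / 2)))) *
              ENNReal.ofReal (s ^ (c - 1) * Real.exp (-(τ / (1 + τ) * ‖x‖ ^ 2 * s))) := by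
          refine setLIntegral_congr_fun measurableSet_Ioi fun s hs => ?_
          have hs' : (0 : ℝ) < s := hs
          rw [← lintegral_Ioi_comp_mul _ hs', ← lintegral_const_mul _ (by fun_prop)]
          refine setLIntegral_congr_fun measurableSet_Ioi fun τ hτ => ?_
          have hτ' : (0 : ℝ) < τ := hτ
          rw [← ENNReal.ofReal_mul (by positivity), ← ENNReal.ofReal_mul (by positivity)]
          congr 1
          have e1 : s * (s * τ) / (s + s * τ) * ‖x‖ ^ 2 = τ / (1 + τ) * ‖x‖ ^ 2 * s := by
            field_simp
          have e2 : s ^ (c - 1) = s * (s ^ (a / 2 - 1) * s ^ (b / 2 - 1) * s ^ (-((n : ℝ) / 2))) := by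
            rw [← Real.rpow_add hs', ← Real.rpow_add hs']
            nth_rewrite 2 [← Real.rpow_one s]
            rw [← Real.rpow_add hs']
            congr 1; rw [hc]; ring
          rw [e1, e2, Real.mul_rpow hs'.le hτ'.le, show s + s * τ = s * (1 + τ) by ring,
            Real.div_rpow Real.pi_pos.le (by positivity), Real.mul_rpow hs'.le (by positivity),
            Real.rpow_neg hs'.le, Real.rpow_neg (by positivity)]
          field_simp
      _ = ∫⁻ τ in Ioi (0 : ℝ), ∫⁻ s in Ioi (0 : ℝ),
            ENNReal.ofReal (Real.pi ^ ((n : ℝ) / 2) *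
              (τ ^ (b / 2 - 1) * (1 + τ) ^ (-((n : ℝ) / 2)))) *
              ENNReal.ofReal (s ^ (c - 1) * Real.exp (-(τ / (1 + τ) * ‖x‖ ^ 2 * s))) :=
          lintegral_lintegral_swap (by fun_prop)
      _ = ∫⁻ τ in Ioi (0 : ℝ),
            ENNReal.ofReal (Real.pi ^ ((n : ℝ) / 2) * Real.Gamma c * ‖x‖ ^ (-(2 * c))) *
            ENNReal.ofReal (τ ^ ((n - a) / 2 - 1) * (1 + τ) ^ (-((n - b) / 2 + (n - a) / 2))) := by
          refine setLIntegral_congr_fun measurableSet_Ioi fun τ hτ => ?_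
          have hτ' : (0 : ℝ) < τ := hτ
          rw [lintegral_const_mul _ (by fun_prop),
            lintegral_rpow_mul_exp_neg_mul_Ioi hc0 (by positivity),
            ← ENNReal.ofReal_mul (by positivity), ← ENNReal.ofReal_mul (by positivity)]
          congr 1
          rw [Real.mul_rpow (by positivity) (by positivity), Real.div_rpow hτ'.le (by positivity),
            show -((n - b) / 2 + (n - a) / 2) = -((n : ℝ) / 2) + c by rw [hc]; ring,
            show (n - a) / 2 - 1 = (b / 2 - 1) + -c by rw [hc]; ring,
            show -(2 * c) = (2 : ℕ) * (-c) by push_cast; ring, Real.rpow_natCast_mul hx'.le,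
            Real.rpow_add hτ', Real.rpow_add (by positivity), Real.rpow_neg (x := 1 + τ)
              (by positivity) c]
          field_simp
      _ = _ := by
          rw [lintegral_const_mul _ (by fun_prop),
            lintegral_rpow_mul_one_add_rpow (by linarith) (by linarith)]
  rw [← ENNReal.mul_right_inj (a := ENNReal.ofReal (Real.Gamma (a / 2) * Real.Gamma (b / 2)))
    (by simpa using hGab) ENNReal.ofReal_ne_top, key, ← ENNReal.ofReal_mul (by positivity),
    ← ENNReal.ofReal_mul hGab.le]
  congr 1
  unfold rieszCompositionConst
  rw [show (n : ℝ) - a - b = -(2 * c) by rw [hc]; ring,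
    show (2 * (n : ℝ) - a - b) / 2 = (n - b) / 2 + (n - a) / 2 by ring, ← hc]
  field_simp

/-! ### Schur's test and the Stein-Weiss inequality -/

/-- Schur's test with weights `u`, `v`. -/
theorem lintegral_lintegral_mul_rpow_le {X Y : Type*} [MeasurableSpace X] [MeasurableSpace Y]
    {μ : Measure X} {ν : Measure Y} [SFinite μ] [SFinite ν] {p q : ℝ} (hpq : p.HolderConjugate q)
    {K : X → Y → ℝ≥0∞} (hK : Measurable (Function.uncurry K)) {u : Y → ℝ≥0∞} (hu : Measurable u)
    {v : X → ℝ≥0∞} (hv : Measurable v) {h : Y → ℝ≥0∞} (hh : Measurable h) {C : ℝ≥0∞}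
    (hu0 : ∀ᵐ y ∂ν, u y ≠ 0 ∧ u y ≠ ∞)
    (h1 : ∀ᵐ x ∂μ, ∫⁻ y, K x y * u y ^ q ∂ν ≤ C * v x ^ q)
    (h2 : ∀ᵐ y ∂ν, ∫⁻ x, K x y * v x ^ p ∂μ ≤ C * u y ^ p) :
    ∫⁻ x, (∫⁻ y, K x y * h y ∂ν) ^ p ∂μ ≤ C ^ p * ∫⁻ y, h y ^ p ∂ν := by
  have hp0 := hpq.pos
  have hq0 := hpq.symm.pos
  have hsum : 1 / q + 1 / p = 1 := by
    have := hpq.inv_add_inv_eq_one; simp only [one_div]; linarith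
  have hKx : ∀ x, Measurable (K x) := fun x => hK.comp measurable_prodMk_left
  have hKy : ∀ y, Measurable (fun x => K x y) := fun y => hK.comp measurable_prodMk_right
  have holder : ∀ x, ∫⁻ y, K x y * h y ∂ν ≤
      (∫⁻ y, K x y * u y ^ q ∂ν) ^ (1 / q) *
        (∫⁻ y, K x y * ((u y)⁻¹ * h y) ^ p ∂ν) ^ (1 / p) := by
    intro x
    have := ENNReal.lintegral_mul_le_Lp_mul_Lq ν hpq.symm
      (f := fun y => K x y ^ (1 / q) * u y) (g := fun y => K x y ^ (1 / p) * ((u y)⁻¹ * h y))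
      (((hKx x).pow_const _).mul hu).aemeasurable
      (((hKx x).pow_const _).mul (hu.inv.mul hh)).aemeasurable
    refine le_trans (le_of_eq (lintegral_congr_ae ?_)) (this.trans (le_of_eq ?_))
    · filter_upwards [hu0] with y hy
      simp only [Pi.mul_apply]
      calc K x y * h y = K x y ^ (1 / q + 1 / p) * (u y * (u y)⁻¹) * h y := by
            rw [hsum, ENNReal.rpow_one, ENNReal.mul_inv_cancel hy.1 hy.2, mul_one]
        _ = _ := by rw [ENNReal.rpow_add_of_nonneg _ _ (by positivity) (by positivity)]; ring
    · congr 3 <;> ext y <;> rw [ENNReal.mul_rpow_of_nonneg _ _ (by positivity), ← ENNReal.rpow_mul,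
        one_div, inv_mul_cancel₀ (by positivity), ENNReal.rpow_one]
  -- Hölder gives `(∫ K h)^p ≤ (C v^q)^{p/q} ∫ K u^{-p} h^p`; then integrate in `x` first
  have hpq1 : p / q + 1 = p := by
    have := hsum; field_simp at this ⊢; linarith
  calc ∫⁻ x, (∫⁻ y, K x y * h y ∂ν) ^ p ∂μ
      ≤ ∫⁻ x, C ^ (p / q) * ∫⁻ y, v x ^ p * (K x y * ((u y)⁻¹ * h y) ^ p) ∂ν ∂μ := by
        refine lintegral_mono_ae ?_
        filter_upwards [h1] with x hx
        calc (∫⁻ y, K x y * h y ∂ν) ^ p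
            ≤ ((C * v x ^ q) ^ (1 / q) *
              (∫⁻ y, K x y * ((u y)⁻¹ * h y) ^ p ∂ν) ^ (1 / p)) ^ p := by
              refine ENNReal.rpow_le_rpow ((holder x).trans ?_) hp0.le
              gcongr
          _ = _ := by
              rw [ENNReal.mul_rpow_of_nonneg _ _ hp0.le, ← ENNReal.rpow_mul, ← ENNReal.rpow_mul,
                ENNReal.mul_rpow_of_nonneg _ _ (by positivity), ← ENNReal.rpow_mul,
                lintegral_const_mul (v x ^ p)
                  (show Measurable fun y => K x y * ((u y)⁻¹ * h y) ^ p from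
                    (hKx x).mul ((hu.inv.mul hh).pow_const _)), ← mul_assoc (C ^ _),
                ← mul_assoc q, show 1 / q * p = p / q by ring, mul_one_div_cancel hq0.ne', one_mul,
                one_div_mul_cancel hp0.ne', ENNReal.rpow_one]
    _ = C ^ (p / q) * ∫⁻ y, ∫⁻ x, v x ^ p * (K x y * ((u y)⁻¹ * h y) ^ p) ∂μ ∂ν := by
        have hm : Measurable (Function.uncurry fun x y =>
            v x ^ p * (K x y * ((u y)⁻¹ * h y) ^ p)) := by
          unfold Function.uncurry at hK ⊢
          fun_prop
        rw [lintegral_const_mul _ hm.lintegral_prod_right, lintegral_lintegral_swap hm.aemeasurable]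
    _ ≤ C ^ (p / q) * ∫⁻ y, C * h y ^ p ∂ν := by
        refine mul_le_mul_right (lintegral_mono_ae ?_) _
        filter_upwards [h2, hu0] with y hy hy0
        calc ∫⁻ x, v x ^ p * (K x y * ((u y)⁻¹ * h y) ^ p) ∂μ
            = ((u y)⁻¹ * h y) ^ p * ∫⁻ x, K x y * v x ^ p ∂μ := by
              rw [← lintegral_const_mul _
                (show Measurable fun x => K x y * v x ^ p from (hKy y).mul (hv.pow_const _))]
              refine lintegral_congr fun x => ?_
              ring
          _ ≤ ((u y)⁻¹ * h y) ^ p * (C * u y ^ p) := by gcongr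
          _ = C * (((u y)⁻¹ * u y) * h y) ^ p := by
              simp only [ENNReal.mul_rpow_of_nonneg _ _ hp0.le]; ring
          _ = C * h y ^ p := by rw [ENNReal.inv_mul_cancel hy0.1 hy0.2, one_mul]
    _ = C ^ p * ∫⁻ y, h y ^ p ∂ν := by
        rw [lintegral_const_mul _ (hh.pow_const _), ← mul_assoc]
        congr 1
        nth_rewrite 2 [← ENNReal.rpow_one C]
        rw [← ENNReal.rpow_add_of_nonneg _ _ (by positivity) zero_le_one, hpq1]

/-- The Stein-Weiss inequality with its sharp constant: Schur's test for the homogeneous kernel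
`|x|^{-α} |x - y|^{-λ} |y|^{-b}` with the weights `|x|^{-n/(pq)}`, both conditions of which are
instances of the Riesz composition formula with one and the same constant. -/
theorem lintegral_steinWeiss_le {n : ℕ} {p q lam α b : ℝ} (hpq : p.HolderConjugate q)
    (hlam : 0 < lam) (hlamn : lam < n) (hα : α < n / p) (hb : b < n / q)
    (hsum : (n : ℝ) = lam + α + b) {h : 𝔼 n → ℝ≥0∞} (hh : Measurable h) :
    ∫⁻ x : 𝔼 n, (∫⁻ y : 𝔼 n,
        ENNReal.ofReal (‖x‖ ^ (-α) * ‖x - y‖ ^ (-lam) * ‖y‖ ^ (-b)) * h y) ^ p ≤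
      ENNReal.ofReal (rieszCompositionConst n lam (b + n / p)) ^ p * ∫⁻ y, h y ^ p := by
  have hn : (0 : ℝ) < n := hlam.trans hlamn
  have hn' : 0 < n := by exact_mod_cast hn
  have : Nonempty (Fin n) := ⟨⟨0, hn'⟩⟩
  have hp0 := hpq.pos
  have hq0 := hpq.symm.pos
  have hnpq : (n : ℝ) / p + n / q = n := by
    have := hpq.inv_add_inv_eq_one
    rw [div_eq_mul_inv, div_eq_mul_inv, ← mul_add, this, mul_one]
  -- the constant is invariant under `(α, p) ↔ (b, q)`
  have hconst : rieszCompositionConst n lam (α + n / q) = rieszCompositionConst n lam (b + n / p) := by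
    unfold rieszCompositionConst
    have e1 : (n - (α + n / q)) / 2 = (lam + (b + n / p) - n) / 2 := by linarith
    have e2 : (lam + (α + n / q) - n) / 2 = (n - (b + n / p)) / 2 := by linarith
    have e3 : (α + n / q) / 2 = (2 * n - lam - (b + n / p)) / 2 := by linarith
    have e4 : (2 * n - lam - (α + n / q)) / 2 = (b + n / p) / 2 := by linarith
    rw [e1, e2, e3, e4]
    ring
  have hpow : ∀ (r s : ℝ) (x : 𝔼 n), 0 ≤ s →
      ENNReal.ofReal (‖x‖ ^ r) ^ s = ENNReal.ofReal (‖x‖ ^ (r * s)) := by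
    intro r s x hs
    rw [ENNReal.ofReal_rpow_of_nonneg (by positivity) hs, Real.rpow_mul (norm_nonneg _)]
  have hx0 : ∀ᵐ x : 𝔼 n, x ≠ 0 := by simp [ae_iff]
  refine lintegral_lintegral_mul_rpow_le hpq
    (K := fun x y => ENNReal.ofReal (‖x‖ ^ (-α) * ‖x - y‖ ^ (-lam) * ‖y‖ ^ (-b)))
    (u := fun y => ENNReal.ofReal (‖y‖ ^ (-(n / (p * q)))))
    (v := fun y => ENNReal.ofReal (‖y‖ ^ (-(n / (p * q))))) ?_ (by fun_prop) (by fun_prop) hh ?_ ?_ ?_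
  · unfold Function.uncurry
    fun_prop
  · filter_upwards [hx0] with x hx
    have : 0 < ‖x‖ := norm_pos_iff.2 hx
    refine ⟨?_, ENNReal.ofReal_ne_top⟩
    simp only [ne_eq, ENNReal.ofReal_eq_zero, not_le]
    positivity
  · filter_upwards [hx0] with x hx
    have hx' : 0 < ‖x‖ := norm_pos_iff.2 hx
    simp_rw [hpow _ _ _ hq0.le]
    have := lintegral_norm_sub_rpow_mul_norm_rpow (b := b + n / p) hlam hlamn (by linarith)
      (by linarith) (by linarith) hx
    apply le_of_eq
    calc _ = ∫⁻ y, ENNReal.ofReal (‖x‖ ^ (-α)) *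
          ENNReal.ofReal (‖x - y‖ ^ (-lam) * ‖y‖ ^ (-(b + n / p))) := by
          refine lintegral_congr_ae ?_
          filter_upwards [hx0] with y hy
          have hy' : 0 < ‖y‖ := norm_pos_iff.2 hy
          rw [← ENNReal.ofReal_mul (by positivity), ← ENNReal.ofReal_mul (by positivity)]
          congr 1
          rw [show -(b + n / p) = -b + -(n / (p * q)) * q by field_simp; ring, Real.rpow_add hy']
          ring
      _ = _ := by
          rw [lintegral_const_mul _ (by fun_prop), this, mul_comm, ← ENNReal.ofReal_mul',
            ← ENNReal.ofReal_mul']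
          · congr 1
            rw [mul_assoc, ← Real.rpow_add hx']
            congr 2
            rw [show -(n / (p * q)) * q = -(n / p) by field_simp]
            linarith
          · positivity
          · positivity
  · filter_upwards [hx0] with x hx
    have hx' : 0 < ‖x‖ := norm_pos_iff.2 hx
    simp_rw [hpow _ _ _ hp0.le]
    have := lintegral_norm_sub_rpow_mul_norm_rpow (b := α + n / q) hlam hlamn (by linarith)
      (by linarith) (by linarith) hx
    rw [← hconst]
    apply le_of_eq
    calc _ = ∫⁻ y, ENNReal.ofReal (‖x‖ ^ (-b)) *
          ENNReal.ofReal (‖x - y‖ ^ (-lam) * ‖y‖ ^ (-(α + n / q))) := by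
          refine lintegral_congr_ae ?_
          filter_upwards [hx0] with y hy
          have hy' : 0 < ‖y‖ := norm_pos_iff.2 hy
          rw [← ENNReal.ofReal_mul (by positivity), ← ENNReal.ofReal_mul (by positivity)]
          congr 1
          rw [show -(α + n / q) = -α + -(n / (p * q)) * p by field_simp; ring, Real.rpow_add hy',
            norm_sub_rev]
          ring
      _ = _ := by
          rw [lintegral_const_mul _ (by fun_prop), this, mul_comm, ← ENNReal.ofReal_mul',
            ← ENNReal.ofReal_mul']
          · congr 1
            rw [mul_assoc, ← Real.rpow_add hx']
            congr 2
            rw [show -(n / (p * q)) * p = -(n / q) by field_simp]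
            linarith
          · positivity
          · positivity

/-! ### The weighted Hardy inequality -/

theorem gradNorm_nonneg {n : ℕ} (f : 𝔼 n → ℂ) (x : 𝔼 n) : 0 ≤ gradNorm f x := Real.sqrt_nonneg _

@[fun_prop]
theorem measurable_gradNorm {n : ℕ} (f : 𝔼 n → ℂ) : Measurable (gradNorm f) := by
  unfold gradNorm
  have := fun j : Fin n => measurable_fderiv_apply_const ℝ f (EuclideanSpace.single j 1)
  fun_prop

theorem norm_fderiv_apply_le_gradNorm {n : ℕ} (f : 𝔼 n → ℂ) (x v : 𝔼 n) :
    ‖fderiv ℝ f x v‖ ≤ ‖v‖ * gradNorm f x := by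
  have hv : v = ∑ j, v j • EuclideanSpace.single j (1 : ℝ) := by
    have := (EuclideanSpace.basisFun (Fin n) ℝ).sum_repr v
    simpa using this.symm
  calc ‖fderiv ℝ f x v‖ = ‖∑ j, v j • fderiv ℝ f x (EuclideanSpace.single j 1)‖ := by
        conv_lhs => rw [hv]
        simp only [map_sum, map_smul]
    _ ≤ ∑ j, ‖v j‖ * ‖fderiv ℝ f x (EuclideanSpace.single j 1)‖ := by
        refine (norm_sum_le _ _).trans (le_of_eq ?_)
        simp only [norm_smul]
    _ ≤ _ := by
        rw [EuclideanSpace.norm_eq]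
        exact Real.sum_mul_le_sqrt_mul_sqrt _ _ _

/-- Integration of the radial derivative from infinity, for a function that comes arbitrarily
close to `0` along the ray through `x`. -/
theorem enorm_le_lintegral_gradNorm {n : ℕ} {f : 𝔼 n → ℂ} (hf : ContDiffOn ℝ 1 f {0}ᶜ)
    {x : 𝔼 n} (hx : x ≠ 0) (hdecay : ∀ ε > 0, ∃ᶠ t : ℝ in atTop, ‖f (t • x)‖ < ε) :
    ‖f x‖ₑ ≤ ∫⁻ t in Ioi (1 : ℝ), ENNReal.ofReal (‖x‖ * gradNorm f (t • x)) := by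
  have hopen : IsOpen ({0}ᶜ : Set (𝔼 n)) := isOpen_compl_singleton
  have hmem : ∀ t ∈ Ioi (0 : ℝ), t • x ∈ ({0}ᶜ : Set (𝔼 n)) := fun t ht => by
    simp only [mem_compl_iff, mem_singleton_iff, smul_eq_zero, not_or]
    exact ⟨ne_of_gt ht, hx⟩
  have hderiv : ∀ t ∈ Ioi (0 : ℝ), HasDerivAt (fun t : ℝ => f (t • x)) (fderiv ℝ f (t • x) x) t := by
    intro t ht
    have h1 : HasFDerivAt f (fderiv ℝ f (t • x)) (t • x) :=
      ((hf.differentiableOn one_ne_zero).differentiableAt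
        (hopen.mem_nhds (hmem t ht))).hasFDerivAt
    have h2 : HasDerivAt (fun t : ℝ => t • x) x t := by
      simpa using (hasDerivAt_id t).smul_const x
    exact h1.comp_hasDerivAt t h2
  have hcont : ContinuousOn (fun t : ℝ => fderiv ℝ f (t • x) x) (Ioi 0) := by
    have h1 : ContinuousOn (fderiv ℝ f) {0}ᶜ := hf.continuousOn_fderiv_of_isOpen hopen le_rfl
    have h2 : ContinuousOn (fun t : ℝ => fderiv ℝ f (t • x)) (Ioi 0) :=
      h1.comp (by fun_prop) hmem
    exact h2.clm_apply continuousOn_const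
  refine ENNReal.le_of_forall_pos_le_add fun ε hε _ => ?_
  obtain ⟨T, hT, hT1⟩ := ((hdecay ε hε).and_eventually (eventually_gt_atTop 1)).exists
  have hsub : uIcc 1 T ⊆ Ioi 0 := by
    rw [uIcc_of_le hT1.le]; exact fun t ht => zero_lt_one.trans_le ht.1
  have hftc : ∫ t in (1 : ℝ)..T, fderiv ℝ f (t • x) x = f (T • x) - f x := by
    rw [intervalIntegral.integral_eq_sub_of_hasDerivAt (fun t ht => hderiv t (hsub ht))
      (hcont.mono hsub).intervalIntegrable, one_smul]
  have hfx : f x = f (T • x) - ∫ t in (1 : ℝ)..T, fderiv ℝ f (t • x) x := by rw [hftc]; ring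
  calc ‖f x‖ₑ ≤ ‖f (T • x)‖ₑ + ‖∫ t in (1 : ℝ)..T, fderiv ℝ f (t • x) x‖ₑ := by
        conv_lhs => rw [hfx]
        exact enorm_sub_le
    _ ≤ ε + ∫⁻ t in Ioi (1 : ℝ), ENNReal.ofReal (‖x‖ * gradNorm f (t • x)) := by
        gcongr
        · rw [← ofReal_norm, ← ENNReal.ofReal_coe_nnreal]
          exact ENNReal.ofReal_le_ofReal hT.le
        · rw [intervalIntegral.integral_of_le hT1.le]
          refine (enorm_integral_le_lintegral_enorm _).trans ?_
          refine (lintegral_mono fun t => ?_).trans (lintegral_mono_set Ioc_subset_Ioi_self)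
          rw [← ofReal_norm]
          exact ENNReal.ofReal_le_ofReal (norm_fderiv_apply_le_gradNorm f _ _)
    _ = _ := add_comm _ _

theorem lintegral_Ioi_one_rpow_neg {s : ℝ} (hs : 1 < s) :
    ∫⁻ t in Ioi (1 : ℝ), ENNReal.ofReal (t ^ (-s)) = ENNReal.ofReal (s - 1)⁻¹ := by
  rw [← ofReal_integral_eq_lintegral_ofReal (integrableOn_Ioi_rpow_of_lt (by linarith) one_pos),
    integral_Ioi_rpow_of_lt (by linarith) one_pos]
  · congr 1
    rw [Real.one_rpow, ← neg_div_neg_eq, neg_neg, one_div]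
    ring
  · filter_upwards [ae_restrict_mem measurableSet_Ioi] with t ht
    have : (0 : ℝ) < t := zero_lt_one.trans ht
    positivity

/-- Hölder's inequality on `(1, ∞)` against the density `t ^ (-s)`. -/
theorem lintegral_Ioi_one_rpow_le {p s : ℝ} (hp : 1 < p) (hs : 1 < s) {G : ℝ → ℝ≥0∞}
    (hG : Measurable G) :
    (∫⁻ t in Ioi (1 : ℝ), G t) ^ p ≤
      ENNReal.ofReal (s - 1)⁻¹ ^ (p - 1) *
        ∫⁻ t in Ioi (1 : ℝ), ENNReal.ofReal (t ^ (s * (p - 1))) * G t ^ p := by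
  have hpq := Real.HolderConjugate.conjExponent hp
  set q := p.conjExponent
  have hp0 := hpq.pos
  have hq0 := hpq.symm.pos
  have hqp : p / q = p - 1 := by
    have := hpq.inv_add_inv_eq_one; field_simp at this ⊢; linarith
  have := ENNReal.lintegral_mul_le_Lp_mul_Lq (volume.restrict (Ioi (1 : ℝ))) hpq.symm
    (f := fun t => ENNReal.ofReal (t ^ (-(s / q)))) (g := fun t => ENNReal.ofReal (t ^ (s / q)) * G t)
    (by fun_prop) (by fun_prop)
  have e1 : ∫⁻ t in Ioi (1 : ℝ), G t = ∫⁻ t in Ioi (1 : ℝ), ((fun t => ENNReal.ofReal (t ^ (-(s / q))))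
      * (fun t => ENNReal.ofReal (t ^ (s / q)) * G t)) t := by
    refine setLIntegral_congr_fun measurableSet_Ioi fun t ht => ?_
    have ht0 : (0 : ℝ) < t := zero_lt_one.trans ht
    rw [Pi.mul_apply, ← mul_assoc, ← ENNReal.ofReal_mul (by positivity), ← Real.rpow_add ht0]
    simp
  have e2 : ∫⁻ t in Ioi (1 : ℝ), ENNReal.ofReal (t ^ (-(s / q))) ^ q = ENNReal.ofReal (s - 1)⁻¹ := by
    rw [← lintegral_Ioi_one_rpow_neg hs]
    refine setLIntegral_congr_fun measurableSet_Ioi fun t ht => ?_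
    have ht0 : (0 : ℝ) < t := zero_lt_one.trans ht
    rw [ENNReal.ofReal_rpow_of_nonneg (by positivity) hq0.le, ← Real.rpow_mul ht0.le]
    congr 2
    field_simp
  have e3 : ∫⁻ t in Ioi (1 : ℝ), (ENNReal.ofReal (t ^ (s / q)) * G t) ^ p =
      ∫⁻ t in Ioi (1 : ℝ), ENNReal.ofReal (t ^ (s * (p - 1))) * G t ^ p := by
    refine setLIntegral_congr_fun measurableSet_Ioi fun t ht => ?_
    have ht0 : (0 : ℝ) < t := zero_lt_one.trans ht
    rw [ENNReal.mul_rpow_of_nonneg _ _ hp0.le, ENNReal.ofReal_rpow_of_nonneg (by positivity) hp0.le,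
      ← Real.rpow_mul ht0.le, ← hqp]
    congr 3
    field_simp
  rw [← e1, e2, e3] at this
  refine (ENNReal.rpow_le_rpow this hp0.le).trans (le_of_eq ?_)
  rw [ENNReal.mul_rpow_of_nonneg _ _ hp0.le, ← ENNReal.rpow_mul, ← ENNReal.rpow_mul,
    one_div_mul_cancel hp0.ne', ENNReal.rpow_one, one_div_mul_eq_div, hqp]

/-- The weighted Hardy inequality `‖|x|^{β-1} f‖_p ≤ (n/p + β - 1)⁻¹ ‖|x|^β ∇f‖_p` with its sharp
constant, for functions that are continuously differentiable away from the origin and vanish at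
infinity, in a weak sense, along almost every ray. -/
theorem lintegral_hardy_le {n : ℕ} {p β : ℝ} (hn : 0 < n) (hp : 1 < p) (hβ : 1 - n / p < β)
    {f : 𝔼 n → ℂ} (hf : ContDiffOn ℝ 1 f {0}ᶜ)
    (hdecay : ∀ᵐ x : 𝔼 n, ∀ ε > 0, ∃ᶠ t : ℝ in atTop, ‖f (t • x)‖ < ε) :
    ∫⁻ x : 𝔼 n, ENNReal.ofReal (‖x‖ ^ (β - 1) * ‖f x‖) ^ p ≤
      ENNReal.ofReal (n / p + β - 1)⁻¹ ^ p *
        ∫⁻ x : 𝔼 n, ENNReal.ofReal (‖x‖ ^ β * gradNorm f x) ^ p := by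
  have : Nonempty (Fin n) := ⟨⟨0, hn⟩⟩
  have hp0 : 0 < p := by linarith
  -- with this exponent in Hölder's inequality, the scaling factors also integrate to `(s - 1)⁻¹`
  set s : ℝ := n / p + β with hs
  have hs1 : 1 < s := by linarith
  have hx0 : ∀ᵐ x : 𝔼 n, x ≠ 0 := by simp [ae_iff]
  set W : 𝔼 n → ℝ≥0∞ := fun x => ENNReal.ofReal (‖x‖ ^ β * gradNorm f x) with hW
  have hWm : Measurable W := by fun_prop
  have hpoint : ∀ᵐ x : 𝔼 n, ENNReal.ofReal (‖x‖ ^ (β - 1) * ‖f x‖) ≤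
      ∫⁻ t in Ioi (1 : ℝ), ENNReal.ofReal (t ^ (-β)) * W (t • x) := by
    filter_upwards [hdecay, hx0] with x hx hx0
    have hx' : 0 < ‖x‖ := norm_pos_iff.2 hx0
    have := enorm_le_lintegral_gradNorm hf hx0 hx
    rw [ENNReal.ofReal_mul (by positivity), ofReal_norm]
    refine (mul_le_mul_right this _).trans (le_of_eq ?_)
    rw [← lintegral_const_mul _ (by fun_prop)]
    refine setLIntegral_congr_fun measurableSet_Ioi fun t ht => ?_
    have ht0 : (0 : ℝ) < t := zero_lt_one.trans ht
    rw [hW, ← ENNReal.ofReal_mul (by positivity), ← ENNReal.ofReal_mul (by positivity), norm_smul,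
      Real.norm_of_nonneg ht0.le, Real.mul_rpow ht0.le hx'.le, Real.rpow_neg ht0.le,
      Real.rpow_sub_one hx'.ne']
    congr 1
    field_simp
  calc ∫⁻ x : 𝔼 n, ENNReal.ofReal (‖x‖ ^ (β - 1) * ‖f x‖) ^ p
      ≤ ∫⁻ x : 𝔼 n, ENNReal.ofReal (s - 1)⁻¹ ^ (p - 1) * ∫⁻ t in Ioi (1 : ℝ),
          ENNReal.ofReal (t ^ (s * (p - 1))) * (ENNReal.ofReal (t ^ (-β)) * W (t • x)) ^ p := by
        refine lintegral_mono_ae ?_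
        filter_upwards [hpoint] with x hx
        exact (ENNReal.rpow_le_rpow hx hp0.le).trans (lintegral_Ioi_one_rpow_le hp hs1 (by fun_prop))
    _ = ENNReal.ofReal (s - 1)⁻¹ ^ (p - 1) * ∫⁻ t in Ioi (1 : ℝ), ∫⁻ x : 𝔼 n,
          ENNReal.ofReal (t ^ (s * (p - 1))) * (ENNReal.ofReal (t ^ (-β)) * W (t • x)) ^ p := by
        have hm : Measurable (Function.uncurry fun (x : 𝔼 n) (t : ℝ) =>
            ENNReal.ofReal (t ^ (s * (p - 1))) * (ENNReal.ofReal (t ^ (-β)) * W (t • x)) ^ p) := by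
          unfold Function.uncurry
          fun_prop
        rw [lintegral_const_mul _ hm.lintegral_prod_right, lintegral_lintegral_swap hm.aemeasurable]
    _ = ENNReal.ofReal (s - 1)⁻¹ ^ (p - 1) * ∫⁻ t in Ioi (1 : ℝ),
          ENNReal.ofReal (t ^ (-s)) * ∫⁻ x, W x ^ p := by
        congr 1
        refine setLIntegral_congr_fun measurableSet_Ioi fun t ht => ?_
        have ht0 : (0 : ℝ) < t := zero_lt_one.trans ht
        simp_rw [ENNReal.mul_rpow_of_nonneg _ _ hp0.le, ← mul_assoc]
        rw [lintegral_const_mul _ (by fun_prop), lintegral_comp_smul (fun x => W x ^ p) ht0,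
          ← mul_assoc, ENNReal.ofReal_rpow_of_nonneg (by positivity) hp0.le,
          ← ENNReal.ofReal_mul (by positivity), ← ENNReal.ofReal_mul (by positivity),
          ← Real.rpow_mul ht0.le, ← Real.rpow_add ht0, ← Real.rpow_add ht0]
        congr 3
        rw [hs]
        field_simp
        ring
    _ = ENNReal.ofReal (s - 1)⁻¹ ^ p * ∫⁻ x, W x ^ p := by
        rw [lintegral_mul_const _ (by fun_prop), lintegral_Ioi_one_rpow_neg hs1, ← mul_assoc]
        congr 1
        nth_rewrite 2 [← ENNReal.rpow_one (ENNReal.ofReal (s - 1)⁻¹)]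
        rw [← ENNReal.rpow_add_of_nonneg _ _ (by linarith) zero_le_one, sub_add_cancel]

/-! ### Superposition of Fourier multipliers -/

theorem integrable_norm_rpow_mul_norm {n : ℕ} (hn : 0 < n) {s : ℝ} (hs : -(n : ℝ) < s)
    (h : 𝓢(𝔼 n, ℂ)) : Integrable (fun x : 𝔼 n => ‖x‖ ^ s * ‖h x‖) := by
  have : Nonempty (Fin n) := ⟨⟨0, hn⟩⟩
  obtain ⟨k, hk⟩ := exists_nat_gt (s + n)
  obtain ⟨C, hC⟩ := h.decay 0 0
  obtain ⟨D, hD⟩ := h.decay k 0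
  simp only [norm_iteratedFDeriv_zero, pow_zero, one_mul] at hC hD
  set φ : ℝ → ℝ := fun r => if r ≤ 1 then C * r ^ s else D * r ^ (s - k) with hφ
  have hint : Integrable (fun x : 𝔼 n => φ ‖x‖) := by
    rw [integrable_fun_norm_addHaar, finrank_euclideanSpace_fin,
      ← Ioc_union_Ioi_eq_Ioi zero_le_one, integrableOn_union]
    have hpow : ∀ r : ℝ, 0 < r → r ^ (n - 1) = r ^ ((n : ℝ) - 1) := fun r hr => by
      rw [← Real.rpow_natCast, Nat.cast_sub hn, Nat.cast_one]
    constructor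
    · have h1 : IntegrableOn (fun r : ℝ => C * r ^ (n - 1 + s)) (Ioc 0 1) := by
        have := intervalIntegral.intervalIntegrable_rpow' (a := 0) (b := 1) (r := n - 1 + s)
          (by linarith)
        exact ((intervalIntegrable_iff_integrableOn_Ioc_of_le zero_le_one).1 this).const_mul C
      refine h1.congr_fun (fun r hr => ?_) measurableSet_Ioc
      simp only [hφ, if_pos hr.2, smul_eq_mul]
      rw [hpow r hr.1, Real.rpow_add hr.1]
      ring
    · have h1 : IntegrableOn (fun r : ℝ => D * r ^ (n - 1 + (s - k))) (Ioi 1) :=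
        (integrableOn_Ioi_rpow_of_lt (by linarith) one_pos).const_mul D
      refine h1.congr_fun (fun r hr => ?_) measurableSet_Ioi
      have hr' : (1 : ℝ) < r := hr
      have hr0 : (0 : ℝ) < r := by linarith
      simp only [hφ, if_neg (not_le.2 hr'), smul_eq_mul]
      rw [hpow r hr0, Real.rpow_add hr0]
      ring
  refine hint.mono' (by have := h.continuous.measurable; exact Measurable.aestronglyMeasurable (by fun_prop)) ?_
  filter_upwards with x
  rw [Real.norm_of_nonneg (by positivity)]
  simp only [hφ]
  split_ifs with hx
  · rw [mul_comm]
    gcongr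
    exact hC.2 x
  · have hx0 : 0 < ‖x‖ := by linarith
    calc ‖x‖ ^ s * ‖h x‖ = ‖x‖ ^ (s - k) * (‖x‖ ^ k * ‖h x‖) := by
          rw [← mul_assoc, ← Real.rpow_natCast, ← Real.rpow_add hx0, sub_add_cancel]
      _ ≤ ‖x‖ ^ (s - k) * D := by gcongr; exact hD.2 x
      _ = _ := mul_comm _ _

/-- If a nonnegative Fourier multiplier `w` is a superposition `∫ m_t dt` of nonnegative multipliers,
then so is the corresponding operator, and the triangle inequality applies. -/
theorem enorm_fourierInv_le_lintegral {n : ℕ} {m : ℝ → 𝔼 n → ℝ}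
    (hm : Measurable (Function.uncurry m)) (hm0 : ∀ t ∈ Ioi (0 : ℝ), ∀ ξ, 0 ≤ m t ξ)
    {w : 𝔼 n → ℝ} (hw0 : ∀ ξ, 0 ≤ w ξ)
    (hw : ∀ᵐ ξ, ∫⁻ t in Ioi (0 : ℝ), ENNReal.ofReal (m t ξ) = ENNReal.ofReal (w ξ))
    {H : 𝔼 n → ℂ} (hH : Measurable H) (hint : Integrable (fun ξ => (w ξ : ℂ) * H ξ)) (x : 𝔼 n) :
    ‖𝓕⁻ (fun ξ => (w ξ : ℂ) * H ξ) x‖ₑ ≤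
      ∫⁻ t in Ioi (0 : ℝ), ‖𝓕⁻ (fun ξ => (m t ξ : ℂ) * H ξ) x‖ₑ := by
  have hwint : ∀ᵐ ξ, (w ξ : ℂ) = ∫ t in Ioi (0 : ℝ), (m t ξ : ℂ) := by
    filter_upwards [hw] with ξ hξ
    rw [integral_complex_ofReal, integral_eq_lintegral_of_nonneg_ae
      ((ae_restrict_mem measurableSet_Ioi).mono fun t ht => hm0 t ht ξ)
      (hm.of_uncurry_right).aestronglyMeasurable, hξ, ENNReal.toReal_ofReal (hw0 ξ)]
  have hmx : ∀ t, Measurable (m t) := fun t => hm.of_uncurry_left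
  have hswap : Integrable (Function.uncurry fun (ξ : 𝔼 n) (t : ℝ) =>
      Complex.exp (((2 * Real.pi * inner ℝ ξ x : ℝ) : ℂ) * Complex.I) * ((m t ξ : ℂ) * H ξ))
      ((volume : Measure (𝔼 n)).prod (volume.restrict (Ioi (0 : ℝ)))) := by
    have hmeas : Measurable (Function.uncurry fun (ξ : 𝔼 n) (t : ℝ) =>
      Complex.exp (((2 * Real.pi * inner ℝ ξ x : ℝ) : ℂ) * Complex.I) * ((m t ξ : ℂ) * H ξ)) := by
      have h1 : Measurable fun z : 𝔼 n × ℝ => m z.2 z.1 := hm.comp measurable_swap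
      unfold Function.uncurry
      fun_prop
    refine ⟨hmeas.aestronglyMeasurable, ?_⟩
    rw [hasFiniteIntegral_iff_enorm, lintegral_prod _ hmeas.enorm.aemeasurable]
    refine lt_of_le_of_lt (le_of_eq (lintegral_congr_ae ?_)) hint.2
    filter_upwards [hw] with ξ hξ
    simp only [Function.uncurry, enorm_mul]
    calc _ = ∫⁻ t in Ioi (0 : ℝ), ENNReal.ofReal (m t ξ) * ‖H ξ‖ₑ := by
          refine setLIntegral_congr_fun measurableSet_Ioi fun t ht => ?_
          rw [← ofReal_norm, Complex.norm_exp_ofReal_mul_I, ENNReal.ofReal_one, one_mul,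
            ← ofReal_norm (m t ξ : ℂ), Complex.norm_real, Real.norm_of_nonneg (hm0 t ht ξ)]
      _ = _ := by
          rw [lintegral_mul_const _ (by have := hm.of_uncurry_right (y := ξ); fun_prop), hξ,
            ← ofReal_norm (w ξ : ℂ), Complex.norm_real, Real.norm_of_nonneg (hw0 ξ)]
  have : 𝓕⁻ (fun ξ => (w ξ : ℂ) * H ξ) x =
      ∫ t in Ioi (0 : ℝ), 𝓕⁻ (fun ξ => (m t ξ : ℂ) * H ξ) x := by
    simp_rw [Real.fourierInv_eq', smul_eq_mul]
    rw [← integral_integral_swap hswap]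
    refine integral_congr_ae ?_
    filter_upwards [hwint] with ξ hξ
    rw [hξ, integral_const_mul, integral_mul_const]
  rw [this]
  exact enorm_integral_le_lintegral_enorm _

theorem integral_fourierInv_mul_eq {n : ℕ} {f g : 𝔼 n → ℂ} (hf : Integrable f)
    (hg : Integrable g) : ∫ x, 𝓕⁻ f x * g x = ∫ x, f x * 𝓕⁻ g x := by
  have := VectorFourier.integral_fourierIntegral_smul_eq_flip (L := -innerₗ (𝔼 n))
    (μ := volume) (ν := volume) Real.continuous_fourierChar
    (by simp only [LinearMap.neg_apply, innerₗ_apply_apply]; fun_prop) hf hg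
  have hflip : (-innerₗ (𝔼 n)).flip = -innerₗ (𝔼 n) := by
    ext x y; simp [real_inner_comm]
  rw [hflip] at this
  exact this

/-- The heat semigroup, applied to `𝓕⁻ H`, is convolution with the Gaussian heat kernel. -/
theorem enorm_fourierInv_gaussian_mul_le {n : ℕ} {t : ℝ} (ht : 0 < t) {H : 𝔼 n → ℂ}
    (hH : Integrable H) (x : 𝔼 n) :
    ‖𝓕⁻ (fun ξ => (Real.exp (-(4 * Real.pi ^ 2 * ‖ξ‖ ^ 2 * t)) : ℂ) * H ξ) x‖ₑ ≤
      ∫⁻ y : 𝔼 n, ENNReal.ofReal ((4 * Real.pi * t) ^ (-((n : ℝ) / 2)) *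
        Real.exp (-(‖x - y‖ ^ 2 / 4 * t⁻¹))) * ‖𝓕⁻ H y‖ₑ := by
  have hpi := Real.pi_pos
  set b : ℝ := 4 * Real.pi ^ 2 * t with hb
  have hb0 : 0 < b := by positivity
  have hb0' : 0 < (b : ℂ).re := by simpa using hb0
  set φ : 𝔼 n → ℂ := fun v =>
    Complex.exp (-b * ‖v‖ ^ 2 + 2 * Real.pi * Complex.I * (inner ℝ x v : ℝ)) with hφ
  have hφi : Integrable φ := GaussianFourier.integrable_cexp_neg_mul_sq_norm_add hb0' _ _
  have hφc : Continuous φ := by fun_prop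
  have hFφ : 𝓕 φ = fun w => (((4 * Real.pi * t) ^ (-((n : ℝ) / 2)) *
        Real.exp (-(‖x - w‖ ^ 2 / 4 * t⁻¹)) : ℝ) : ℂ) := by
    ext w
    rw [hφ, fourier_gaussian_innerProductSpace' hb0', finrank_euclideanSpace_fin]
    push_cast
    congr 1
    · rw [show (Real.pi : ℂ) / b = (((4 * Real.pi * t)⁻¹ : ℝ) : ℂ) by
        rw [← Complex.ofReal_div, hb]; congr 1; field_simp]
      rw [show (n : ℂ) / 2 = (((n : ℝ) / 2 : ℝ) : ℂ) by push_cast; rfl,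
        ← Complex.ofReal_cpow (by positivity), Real.inv_rpow (by positivity),
        ← Real.rpow_neg (by positivity), Complex.ofReal_cpow (by positivity)]
    · congr 1
      rw [hb]; push_cast
      have : (Real.pi : ℂ) ≠ 0 := by exact_mod_cast hpi.ne'
      have : (t : ℂ) ≠ 0 := by exact_mod_cast ht.ne'
      field_simp
  have hFφi : Integrable (𝓕 φ) := by
    rw [hFφ]
    refine Integrable.ofReal (Integrable.const_mul ?_ _)
    have h1 := GaussianFourier.integrable_cexp_neg_mul_sq_norm_add (V := 𝔼 n)
      (b := ((1 / (4 * t) : ℝ) : ℂ)) (by rw [Complex.ofReal_re]; positivity) 0 0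
    have h2 := (h1.comp_sub_left x).re
    refine h2.congr (Eventually.of_forall fun y => ?_)
    simp only [zero_mul, add_zero]
    rw [show -((1 / (4 * t) : ℝ) : ℂ) * (‖x - y‖ : ℂ) ^ 2 =
      ((-(‖x - y‖ ^ 2 / 4 * t⁻¹) : ℝ) : ℂ) by push_cast; field_simp]
    rw [← Complex.ofReal_exp]
    exact Complex.ofReal_re _
  -- `φ` is the frequency-side Gaussian modulated by `x`, its transform the heat kernel at `x`
  have hinv : 𝓕⁻ (𝓕 φ) = φ := hφc.fourierInv_fourier_eq hφi hFφi
  have key : 𝓕⁻ (fun ξ => (Real.exp (-(4 * Real.pi ^ 2 * ‖ξ‖ ^ 2 * t)) : ℂ) * H ξ) x =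
      ∫ y, 𝓕 φ y * 𝓕⁻ H y := by
    rw [← integral_fourierInv_mul_eq hFφi hH, hinv, Real.fourierInv_eq']
    congr 1
    ext ξ
    rw [smul_eq_mul, ← mul_assoc, hφ, Complex.ofReal_exp, ← Complex.exp_add, real_inner_comm, hb]
    congr 2
    push_cast
    ring
  rw [key]
  refine (enorm_integral_le_lintegral_enorm _).trans (lintegral_mono fun y => ?_)
  rw [enorm_mul, hFφ, ← ofReal_norm (_ : ℂ), Complex.norm_real, Real.norm_of_nonneg (by positivity)]

/-- Euler's Gamma integral after the substitution `t ↦ t⁻¹`, as it arises from heat kernels. -/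
theorem lintegral_rpow_mul_exp_neg_mul_inv_Ioi {c k : ℝ} (hc : 0 < c) (hk : 0 < k) :
    ∫⁻ t in Ioi (0 : ℝ), ENNReal.ofReal (t ^ (-c - 1) * Real.exp (-(k * t⁻¹))) =
      ENNReal.ofReal (Real.Gamma c * k ^ (-c)) := by
  have h1 := Real.integral_rpow_mul_exp_neg_mul_Ioi hc hk
  have h2 : IntegrableOn (fun t : ℝ => t ^ (c - 1) * Real.exp (-(k * t))) (Ioi 0) := by
    have := integrableOn_rpow_mul_exp_neg_mul_rpow (p := 1) (s := c - 1) (b := k) (by linarith)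
      one_pos hk
    simpa [neg_mul] using this
  have h3 := (integrableOn_Ioi_comp_rpow_iff _ (p := -1) (by norm_num)).2 h2
  have h4 := integral_comp_rpow_Ioi (fun t : ℝ => t ^ (c - 1) * Real.exp (-(k * t))) (p := -1)
    (by norm_num)
  have e : ∀ t ∈ Ioi (0 : ℝ), (|(-1 : ℝ)| * t ^ ((-1 : ℝ) - 1)) •
      ((t ^ (-1 : ℝ)) ^ (c - 1) * Real.exp (-(k * t ^ (-1 : ℝ)))) =
      t ^ (-c - 1) * Real.exp (-(k * t⁻¹)) := by
    intro t ht
    have ht0 : (0 : ℝ) < t := ht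
    rw [← Real.rpow_mul ht0.le, Real.rpow_neg_one, smul_eq_mul, abs_neg, abs_one, one_mul,
      ← mul_assoc, ← Real.rpow_add ht0]
    congr 2
    ring
  rw [← ofReal_integral_eq_lintegral_ofReal (h3.congr_fun e measurableSet_Ioi),
    ← setIntegral_congr_fun measurableSet_Ioi e, h4, h1, mul_comm, one_div,
    Real.inv_rpow hk.le, Real.rpow_neg hk.le]
  filter_upwards [ae_restrict_mem measurableSet_Ioi] with t ht
  have : (0 : ℝ) < t := ht
  positivity

/-! ### Riesz potentials of fractional Laplacians -/

theorem fourierInv_const_mul {n : ℕ} (c : ℂ) (H : 𝔼 n → ℂ) (x : 𝔼 n) :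
    𝓕⁻ (fun ξ => c * H ξ) x = c * 𝓕⁻ H x := by
  simp_rw [Real.fourierInv_eq', smul_eq_mul, ← integral_const_mul]
  congr 1; ext ξ; ring

/-- The Fourier transform of `(-Δ)^r g` decays rapidly enough to be integrable against polynomials. -/
theorem integrable_norm_pow_mul_symbol {n : ℕ} (hn : 0 < n) {r : ℝ} (hr : 0 ≤ r) (k : ℕ)
    (g : 𝓢(𝔼 n, ℂ)) : Integrable (fun ξ : 𝔼 n => ‖ξ‖ ^ k *
      ‖(((4 * Real.pi ^ 2 * ‖ξ‖ ^ 2) ^ r : ℝ) : ℂ) * 𝓕 (g : 𝔼 n → ℂ) ξ‖) := by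
  have : Nonempty (Fin n) := ⟨⟨0, hn⟩⟩
  have hn' : (0 : ℝ) < n := by exact_mod_cast hn
  have h := (integrable_norm_rpow_mul_norm hn (s := k + 2 * r) (neg_lt_zero.2 hn' |>.trans_le (by positivity))
    (𝓕 g)).const_mul
    ((4 * Real.pi ^ 2) ^ r)
  have hx0 : ∀ᵐ x : 𝔼 n, x ≠ 0 := by simp [ae_iff]
  refine h.congr ?_
  filter_upwards [hx0] with ξ hξ
  have hξ' : 0 < ‖ξ‖ := norm_pos_iff.2 hξ
  rw [norm_mul, Complex.norm_real, Real.norm_of_nonneg (by positivity),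
    Real.mul_rpow (x := 4 * Real.pi ^ 2) (by positivity) (by positivity),
    ← SchwartzMap.fourier_coe, Real.rpow_add hξ',
    Real.rpow_natCast, show 2 * r = (2 : ℕ) * r by push_cast; ring, Real.rpow_natCast_mul hξ'.le]
  ring

theorem measurable_symbol {n : ℕ} (r : ℝ) (g : 𝓢(𝔼 n, ℂ)) : Measurable (fun ξ : 𝔼 n =>
      (((4 * Real.pi ^ 2 * ‖ξ‖ ^ 2) ^ r : ℝ) : ℂ) * 𝓕 (g : 𝔼 n → ℂ) ξ) := by
  have := (𝓕 g).continuous.measurable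
  rw [SchwartzMap.fourier_coe] at this
  fun_prop

theorem integrable_symbol {n : ℕ} (hn : 0 < n) {r : ℝ} (hr : 0 ≤ r) (g : 𝓢(𝔼 n, ℂ)) :
    Integrable (fun ξ : 𝔼 n => (((4 * Real.pi ^ 2 * ‖ξ‖ ^ 2) ^ r : ℝ) : ℂ) * 𝓕 (g : 𝔼 n → ℂ) ξ) := by
  have h := integrable_norm_pow_mul_symbol hn hr 0 g
  simp only [pow_zero, one_mul] at h
  exact (integrable_norm_iff (measurable_symbol r g).aestronglyMeasurable).1 h

theorem contDiff_fracLaplacian {n : ℕ} (hn : 0 < n) {r : ℝ} (hr : 0 ≤ r) (g : 𝓢(𝔼 n, ℂ)) :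
    ContDiff ℝ 1 (fracLaplacian r g) := by
  have h : ContDiff ℝ ((1 : ℕ∞) : WithTop ℕ∞) (𝓕 (fun ξ : 𝔼 n =>
      (((4 * Real.pi ^ 2 * ‖ξ‖ ^ 2) ^ r : ℝ) : ℂ) * 𝓕 (g : 𝔼 n → ℂ) ξ)) :=
    Real.contDiff_fourier fun k _ => integrable_norm_pow_mul_symbol hn hr k g
  have h2 : fracLaplacian r g = fun x => 𝓕 (fun ξ : 𝔼 n =>
      (((4 * Real.pi ^ 2 * ‖ξ‖ ^ 2) ^ r : ℝ) : ℂ) * 𝓕 (g : 𝔼 n → ℂ) ξ) (-x) := by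
    ext x
    exact Real.fourierInv_eq_fourier_neg _ _
  rw [h2]
  exact h.comp contDiff_neg

/-- `g` is dominated by the Riesz potential of order `2r` of `|(-Δ)^r g|`: superposing heat
semigroups gives `(-Δ)^{-r}` on the Fourier side and `|x|^{2r-n}` in physical space. -/
theorem enorm_le_lintegral_fracLaplacian {n : ℕ} {r : ℝ} (hr : 0 < r) (hrn : 2 * r < n)
    (g : 𝓢(𝔼 n, ℂ)) (x : 𝔼 n) :
    ‖g x‖ₑ ≤ ENNReal.ofReal (Real.Gamma (n / 2 - r) /
        (Real.pi ^ ((n : ℝ) / 2) * 2 ^ (2 * r) * Real.Gamma r)) *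
      ∫⁻ y : 𝔼 n, ENNReal.ofReal (‖x - y‖ ^ (-(n - 2 * r))) * ‖fracLaplacian r g y‖ₑ := by
  have hn' : (0 : ℝ) < n := by linarith
  have hn : 0 < n := by exact_mod_cast hn'
  have : Nonempty (Fin n) := ⟨⟨0, hn⟩⟩
  have hpi := Real.pi_pos
  have hG := Real.Gamma_pos_of_pos hr
  have hG2 : 0 < Real.Gamma (n / 2 - r) := Real.Gamma_pos_of_pos (by linarith)
  have hx0 : ∀ᵐ x : 𝔼 n, x ≠ 0 := by simp [ae_iff]
  set H : 𝔼 n → ℂ := fun ξ =>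
    (((4 * Real.pi ^ 2 * ‖ξ‖ ^ 2) ^ r : ℝ) : ℂ) * 𝓕 (g : 𝔼 n → ℂ) ξ with hH
  have hHi : Integrable H := integrable_symbol hn hr.le g
  have hFL : fracLaplacian r g = 𝓕⁻ H := rfl
  set w : 𝔼 n → ℝ := fun ξ => (4 * Real.pi ^ 2 * ‖ξ‖ ^ 2) ^ (-r) with hw
  set m : ℝ → 𝔼 n → ℝ := fun t ξ =>
    (Real.Gamma r)⁻¹ * t ^ (r - 1) * Real.exp (-(4 * Real.pi ^ 2 * ‖ξ‖ ^ 2 * t)) with hm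
  have hwH : (fun ξ => (w ξ : ℂ) * H ξ) =ᵐ[volume] 𝓕 (g : 𝔼 n → ℂ) := by
    filter_upwards [hx0] with ξ hξ
    have hξ' : 0 < ‖ξ‖ := norm_pos_iff.2 hξ
    rw [hw, hH]
    simp only
    rw [← mul_assoc, ← Complex.ofReal_mul, ← Real.rpow_add (by positivity)]
    simp
  have hFg : Integrable (𝓕 (g : 𝔼 n → ℂ)) := by
    rw [← SchwartzMap.fourier_coe]; exact (𝓕 g).integrable
  have hg : 𝓕⁻ (fun ξ => (w ξ : ℂ) * H ξ) x = g x := by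
    rw [Real.fourierInv_congr_ae hwH, g.continuous.fourierInv_fourier_eq g.integrable hFg]
  have hmm : Measurable (Function.uncurry m) := by
    unfold Function.uncurry
    fun_prop
  have h1 := enorm_fourierInv_le_lintegral (m := m) hmm
    (fun t ht ξ => by have ht0 : (0 : ℝ) < t := ht
                      positivity) (w := w) (fun ξ => by positivity)
    (by
      filter_upwards [hx0] with ξ hξ
      have hξ' : 0 < ‖ξ‖ := norm_pos_iff.2 hξ
      have := lintegral_rpow_mul_exp_neg_mul_Ioi hr (k := 4 * Real.pi ^ 2 * ‖ξ‖ ^ 2) (by positivity)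
      simp_rw [hm, mul_assoc (Real.Gamma r)⁻¹, ENNReal.ofReal_mul (inv_nonneg.2 hG.le)]
      rw [lintegral_const_mul _ (by fun_prop), this, ← ENNReal.ofReal_mul (by positivity),
        inv_mul_cancel_left₀ hG.ne'])
    (measurable_symbol r g) (hFg.congr hwH.symm) x
  rw [hg] at h1
  refine h1.trans ?_
  have hFm : Measurable (𝓕⁻ H) := by
    rw [← hFL]; exact (contDiff_fracLaplacian hn hr.le g).continuous.measurable
  calc ∫⁻ t in Ioi (0 : ℝ), ‖𝓕⁻ (fun ξ => (m t ξ : ℂ) * H ξ) x‖ₑ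
      ≤ ∫⁻ t in Ioi (0 : ℝ), ∫⁻ y : 𝔼 n, ENNReal.ofReal ((Real.Gamma r)⁻¹ * t ^ (r - 1)) *
          (ENNReal.ofReal ((4 * Real.pi * t) ^ (-((n : ℝ) / 2)) *
            Real.exp (-(‖x - y‖ ^ 2 / 4 * t⁻¹))) * ‖𝓕⁻ H y‖ₑ) := by
        refine setLIntegral_mono' measurableSet_Ioi fun t ht => ?_
        have ht0 : (0 : ℝ) < t := ht
        have e : (fun ξ => (m t ξ : ℂ) * H ξ) = fun ξ =>
            (((Real.Gamma r)⁻¹ * t ^ (r - 1) : ℝ) : ℂ) *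
            ((Real.exp (-(4 * Real.pi ^ 2 * ‖ξ‖ ^ 2 * t)) : ℂ) * H ξ) := by
          ext ξ; rw [hm]; push_cast; ring
        rw [e, fourierInv_const_mul, enorm_mul, ← ofReal_norm (_ : ℂ), Complex.norm_real,
          Real.norm_of_nonneg (by positivity), lintegral_const_mul _ (by fun_prop)]
        exact mul_le_mul_right (enorm_fourierInv_gaussian_mul_le ht0 hHi x) _
    _ = ∫⁻ y : 𝔼 n, ∫⁻ t in Ioi (0 : ℝ), ENNReal.ofReal ((Real.Gamma r)⁻¹ * t ^ (r - 1)) *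
          (ENNReal.ofReal ((4 * Real.pi * t) ^ (-((n : ℝ) / 2)) *
            Real.exp (-(‖x - y‖ ^ 2 / 4 * t⁻¹))) * ‖𝓕⁻ H y‖ₑ) :=
        lintegral_lintegral_swap (by fun_prop)
    _ = ∫⁻ y : 𝔼 n, ENNReal.ofReal (Real.Gamma (n / 2 - r) /
        (Real.pi ^ ((n : ℝ) / 2) * 2 ^ (2 * r) * Real.Gamma r)) *
          (ENNReal.ofReal (‖x - y‖ ^ (-(n - 2 * r))) * ‖𝓕⁻ H y‖ₑ) := by
        have hxy : ∀ᵐ y : 𝔼 n, y ≠ x := by simp [ae_iff]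
        refine lintegral_congr_ae ?_
        filter_upwards [hxy] with y hy
        have hz : 0 < ‖x - y‖ := norm_pos_iff.2 (sub_ne_zero.2 hy.symm)
        have hI := lintegral_rpow_mul_exp_neg_mul_inv_Ioi (c := n / 2 - r) (k := ‖x - y‖ ^ 2 / 4)
          (by linarith) (by positivity)
        calc _ = ∫⁻ t in Ioi (0 : ℝ), ENNReal.ofReal ((Real.Gamma r)⁻¹ *
              (4 * Real.pi) ^ (-((n : ℝ) / 2))) * ‖𝓕⁻ H y‖ₑ * ENNReal.ofReal
                (t ^ (-(n / 2 - r) - 1) * Real.exp (-(‖x - y‖ ^ 2 / 4 * t⁻¹))) := by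
              refine setLIntegral_congr_fun measurableSet_Ioi fun t ht => ?_
              have ht0 : (0 : ℝ) < t := ht
              rw [← mul_assoc, mul_right_comm (ENNReal.ofReal ((Real.Gamma r)⁻¹ * _ ^ (-((n : ℝ) / 2)))),
                ← ENNReal.ofReal_mul (by positivity),
                ← ENNReal.ofReal_mul (by positivity)]
              congr 2
              rw [Real.mul_rpow (by positivity) ht0.le,
                show -((n : ℝ) / 2 - r) - 1 = (r - 1) + -(n / 2) by ring, Real.rpow_add ht0]
              ring
          _ = _ := by
              rw [lintegral_const_mul _ (by fun_prop), hI, mul_right_comm, ← mul_assoc,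
                ← ENNReal.ofReal_mul (by positivity), ← ENNReal.ofReal_mul (by positivity)]
              congr 2
              have h4 : ∀ s : ℝ, (4 : ℝ) ^ s = 2 ^ (2 * s) := fun s => by
                rw [Real.rpow_mul (by norm_num)]; norm_num
              rw [Real.div_rpow (by positivity) (by norm_num), Real.mul_rpow (by norm_num) hpi.le,
                h4, h4, show -((n : ℝ) - 2 * r) = (2 : ℕ) * -(n / 2 - r) by push_cast; ring,
                Real.rpow_natCast_mul hz.le, Real.rpow_neg hpi.le,
                show (2 : ℝ) * -(n / 2) = 2 * -(n / 2 - r) + -(2 * r) by ring,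
                Real.rpow_add (by norm_num), Real.rpow_neg (by norm_num) (2 * r)]
              field_simp
    _ = _ := by rw [lintegral_const_mul _ (by fun_prop), hFL]

/-! ### Integrability of fractional Laplacians -/

theorem fourier_laplacian_apply {n : ℕ} (f : 𝓢(𝔼 n, ℂ)) (ξ : 𝔼 n) :
    𝓕 (Laplacian.laplacian f) ξ = -(4 * Real.pi ^ 2 * ‖ξ‖ ^ 2 : ℝ) * 𝓕 f ξ := by
  have hg : (fun x : 𝔼 n => ‖x‖ ^ 2).HasTemperateGrowth := by fun_prop
  have e : (‖·‖ ^ 2 : 𝔼 n → ℝ) = fun x : 𝔼 n => ‖x‖ ^ 2 := rfl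
  rw [SchwartzMap.laplacian_eq_fourierMultiplierCLM, SchwartzMap.fourierMultiplierCLM_apply,
    FourierTransform.fourier_smul, FourierTransform.fourier_fourierInv_eq, e, smul_apply,
    SchwartzMap.smulLeftCLM_apply_apply hg, Complex.real_smul, Complex.real_smul]
  push_cast
  ring

theorem fourier_iterate_laplacian_apply {n : ℕ} (f : 𝓢(𝔼 n, ℂ)) (k : ℕ) (ξ : 𝔼 n) :
    𝓕 (Laplacian.laplacian^[k] f) ξ = (-(4 * Real.pi ^ 2 * ‖ξ‖ ^ 2 : ℝ)) ^ k * 𝓕 f ξ := by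
  induction k with
  | zero => simp
  | succ k ih => rw [Function.iterate_succ_apply', fourier_laplacian_apply, ih]; ring

theorem coe_iterate_laplacian {n : ℕ} (f : 𝓢(𝔼 n, ℂ)) (k : ℕ) :
    ((Laplacian.laplacian^[k] f : 𝓢(𝔼 n, ℂ)) : 𝔼 n → ℂ) = Laplacian.laplacian^[k] (f : 𝔼 n → ℂ) := by
  induction k with
  | zero => rfl
  | succ k ih =>
    rw [Function.iterate_succ_apply', Function.iterate_succ_apply', ← ih]
    ext x
    exact SchwartzMap.laplacian_apply _ x

theorem fracLaplacian_natCast {n : ℕ} (f : 𝓢(𝔼 n, ℂ)) (k : ℕ) :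
    fracLaplacian (k : ℝ) f = fun x => (-1) ^ k * Laplacian.laplacian^[k] (f : 𝔼 n → ℂ) x := by
  ext x
  have h : ∀ ξ : 𝔼 n, (((4 * Real.pi ^ 2 * ‖ξ‖ ^ 2) ^ (k : ℝ) : ℝ) : ℂ) * 𝓕 (f : 𝔼 n → ℂ) ξ =
      (-1) ^ k * 𝓕 (Laplacian.laplacian^[k] f) ξ := by
    intro ξ
    rw [fourier_iterate_laplacian_apply, ← mul_assoc, ← mul_pow, Real.rpow_natCast,
      SchwartzMap.fourier_coe]
    push_cast
    ring
  unfold fracLaplacian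
  simp_rw [h]
  rw [fourierInv_const_mul]
  change _ * 𝓕⁻ ((𝓕 (Laplacian.laplacian^[k] f) : 𝓢(𝔼 n, ℂ)) : 𝔼 n → ℂ) x = _
  rw [← SchwartzMap.fourierInv_coe, FourierTransform.fourierInv_fourier_eq, coe_iterate_laplacian]

/-- Young's inequality for Fourier multipliers: the `L¹` norm of the kernel of a multiplier bounds
the operator norm on `L¹`, and it is invariant under dilations of the multiplier. -/
theorem lintegral_enorm_fourierInv_comp_smul_mul_le {n : ℕ} (φ g : 𝓢(𝔼 n, ℂ)) {τ : ℝ} (hτ : 0 < τ) :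
    ∫⁻ x, ‖𝓕⁻ (fun ξ : 𝔼 n => φ (τ • ξ) * 𝓕 (g : 𝔼 n → ℂ) ξ) x‖ₑ ≤
      (∫⁻ x, ‖𝓕⁻ (φ : 𝔼 n → ℂ) x‖ₑ) * ∫⁻ x, ‖g x‖ₑ := by
  set e : 𝔼 n ≃L[ℝ] 𝔼 n := ContinuousLinearEquiv.smulLeft (Units.mk0 τ hτ.ne') with he
  set φ' : 𝓢(𝔼 n, ℂ) := SchwartzMap.compCLMOfContinuousLinearEquiv ℂ e φ with hφ'
  have hφ'a : ∀ ξ, φ' ξ = φ (τ • ξ) := fun ξ => rfl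
  set ψ : 𝓢(𝔼 n, ℂ) := 𝓕⁻ φ' with hψ
  have hscale : ∀ x, ψ x = ((τ ^ (-(n : ℝ)) : ℝ) : ℂ) * 𝓕⁻ (φ : 𝔼 n → ℂ) (τ⁻¹ • x) := by
    intro x
    have h1 : ψ x = 𝓕⁻ (φ' : 𝔼 n → ℂ) x := by rw [hψ, SchwartzMap.fourierInv_coe]
    rw [h1, Real.fourierInv_eq', Real.fourierInv_eq']
    have := Measure.integral_comp_smul (volume : Measure (𝔼 n)) (fun ξ : 𝔼 n =>
      Complex.exp (((2 * Real.pi * inner ℝ ξ (τ⁻¹ • x) : ℝ) : ℂ) * Complex.I) • φ ξ) τ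
    rw [finrank_euclideanSpace_fin, abs_of_pos (by positivity), Complex.real_smul] at this
    rw [Real.rpow_neg hτ.le, Real.rpow_natCast, ← this]
    congr 1; ext ξ
    rw [hφ'a, inner_smul_left, inner_smul_right]
    simp only [conj_trivial]
    rw [mul_inv_cancel_left₀ hτ.ne']
  have hψ1 : ∫⁻ x, ‖ψ x‖ₑ = ∫⁻ x, ‖𝓕⁻ (φ : 𝔼 n → ℂ) x‖ₑ := by
    simp_rw [hscale, enorm_mul]
    rw [lintegral_const_mul' _ _ enorm_ne_top,
      lintegral_comp_smul (fun x => ‖𝓕⁻ (φ : 𝔼 n → ℂ) x‖ₑ) (inv_pos.2 hτ), ← mul_assoc,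
      ← ofReal_norm (_ : ℂ), Complex.norm_real, Real.norm_of_nonneg (by positivity),
      ← ENNReal.ofReal_mul (by positivity), Real.inv_rpow hτ.le,
      mul_inv_cancel₀ (by positivity), ENNReal.ofReal_one, one_mul]
  have hconv : 𝓕⁻ (fun ξ : 𝔼 n => φ (τ • ξ) * 𝓕 (g : 𝔼 n → ℂ) ξ) =
      SchwartzMap.convolution (ContinuousLinearMap.mul ℂ ℂ) ψ g := by
    rw [← FourierTransform.fourierInv_fourier_eq (F := 𝓢(𝔼 n, ℂ))
      (SchwartzMap.convolution (ContinuousLinearMap.mul ℂ ℂ) ψ g), SchwartzMap.fourier_convolution,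
      SchwartzMap.fourierInv_coe]
    congr 1; ext ξ
    rw [SchwartzMap.pairing_apply_apply, hψ, FourierTransform.fourier_fourierInv_eq,
      SchwartzMap.fourier_coe]
    rfl
  rw [hconv, ← hψ1]
  calc _ ≤ ∫⁻ x, ∫⁻ y, ‖ψ y‖ₑ * ‖g (x - y)‖ₑ := by
        refine lintegral_mono fun x => ?_
        rw [SchwartzMap.convolution_apply, convolution]
        refine (enorm_integral_le_lintegral_enorm _).trans (lintegral_mono fun y => ?_)
        rw [ContinuousLinearMap.mul_apply', enorm_mul]
    _ = ∫⁻ y, ∫⁻ x, ‖ψ y‖ₑ * ‖g (x - y)‖ₑ := by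
        refine lintegral_lintegral_swap (Measurable.aemeasurable ?_)
        exact (ψ.continuous.measurable.comp measurable_snd).enorm.mul
          (g.continuous.measurable.comp (measurable_fst.sub measurable_snd)).enorm
    _ = ∫⁻ y, ‖ψ y‖ₑ * ∫⁻ x, ‖g x‖ₑ := by
        congr 1; ext y
        rw [lintegral_const_mul' _ _ enorm_ne_top,
          lintegral_sub_right_eq_self (fun x => ‖g x‖ₑ) y]
    _ = _ := lintegral_mul_const _ ψ.continuous.measurable.enorm

theorem lintegral_enorm_fourierInv_lt_top {n : ℕ} (φ : 𝓢(𝔼 n, ℂ)) :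
    ∫⁻ x, ‖𝓕⁻ (φ : 𝔼 n → ℂ) x‖ₑ < ∞ := by
  rw [← SchwartzMap.fourierInv_coe]
  exact (𝓕⁻ φ).integrable.2

/-- The Schwartz function `|ξ|^{2j} ρ(|ξ|)` with a smooth cutoff `ρ` supported in `[0, 1]`. -/
noncomputable def cutoffPow (n j : ℕ) : 𝓢(𝔼 n, ℂ) :=
  HasCompactSupport.toSchwartzMap
    (f := fun ξ : 𝔼 n => (((‖ξ‖ ^ 2) ^ j * Real.smoothTransition (1 - ‖ξ‖ ^ 2) : ℝ) : ℂ))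
    (HasCompactSupport.of_support_subset_isCompact (isCompact_closedBall 0 1) (fun ξ hξ => by
      by_contra h
      rw [mem_closedBall_zero_iff, not_le] at h
      refine hξ ?_
      beta_reduce
      rw [Real.smoothTransition.zero_of_nonpos (by nlinarith), mul_zero, Complex.ofReal_zero]))
    (Complex.ofRealCLM.contDiff.comp (((contDiff_norm_sq ℝ).pow j).mul
      (Real.smoothTransition.contDiff.comp (contDiff_const.sub (contDiff_norm_sq ℝ)))))

theorem cutoffPow_apply (n j : ℕ) (ξ : 𝔼 n) : cutoffPow n j ξ =
    (((‖ξ‖ ^ 2) ^ j * Real.smoothTransition (1 - ‖ξ‖ ^ 2) : ℝ) : ℂ) := rfl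

theorem exists_moment_cutoff {c : ℝ} (hc : 0 < c) : ∃ A : ℝ, 0 < A ∧
    ∫⁻ σ in Ioi (0 : ℝ), ENNReal.ofReal (σ ^ (c - 1) * Real.smoothTransition (1 - σ ^ 2)) =
      ENNReal.ofReal A := by
  have hρ := Real.smoothTransition.continuous.measurable
  have hfin : ∫⁻ σ in Ioi (0 : ℝ),
      ENNReal.ofReal (σ ^ (c - 1) * Real.smoothTransition (1 - σ ^ 2)) < ∞ := by
    have hint : IntegrableOn (fun σ : ℝ => σ ^ (c - 1)) (Ioc 0 1) :=
      (intervalIntegrable_iff_integrableOn_Ioc_of_le zero_le_one).1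
        (intervalIntegral.intervalIntegrable_rpow' (by linarith))
    refine lt_of_le_of_lt ?_ hint.lintegral_lt_top
    rw [← Ioc_union_Ioi_eq_Ioi zero_le_one]
    refine (lintegral_union_le _ _ _).trans ?_
    have h0 : ∫⁻ σ in Ioi (1 : ℝ),
        ENNReal.ofReal (σ ^ (c - 1) * Real.smoothTransition (1 - σ ^ 2)) = 0 := by
      rw [setLIntegral_congr_fun (g := fun _ => 0) measurableSet_Ioi fun σ hσ => ?_, lintegral_zero]
      have hσ1 : (1 : ℝ) < σ := hσ
      simp only
      rw [Real.smoothTransition.zero_of_nonpos (by nlinarith), mul_zero, ENNReal.ofReal_zero]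
    rw [h0, add_zero]
    refine setLIntegral_mono' measurableSet_Ioc fun σ hσ => ENNReal.ofReal_le_ofReal ?_
    have : 0 ≤ σ ^ (c - 1) := Real.rpow_nonneg hσ.1.le _
    exact mul_le_of_le_one_right this (Real.smoothTransition.le_one _)
  have hpos : 0 < ∫⁻ σ in Ioi (0 : ℝ),
      ENNReal.ofReal (σ ^ (c - 1) * Real.smoothTransition (1 - σ ^ 2)) := by
    rw [setLIntegral_pos_iff (by fun_prop)]
    refine lt_of_lt_of_le (b := volume (Ioo (0 : ℝ) 1)) (by simp) (measure_mono fun σ hσ => ?_)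
    refine ⟨?_, hσ.1⟩
    have h1 : 0 < Real.smoothTransition (1 - σ ^ 2) :=
      Real.smoothTransition.pos_of_pos (by nlinarith [hσ.1, hσ.2])
    have h2 : 0 < σ := hσ.1
    simp only [Function.mem_support, ne_eq, ENNReal.ofReal_eq_zero, not_le]
    positivity
  exact ⟨_, ENNReal.toReal_pos hpos.ne' hfin.ne, (ENNReal.ofReal_toReal hfin.ne).symm⟩

theorem measurable_fourierInv_mul {n : ℕ} {m : ℝ → 𝔼 n → ℝ} (hm : Measurable (Function.uncurry m))
    {H : 𝔼 n → ℂ} (hH : Measurable H) :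
    Measurable (Function.uncurry fun (x : 𝔼 n) (t : ℝ) => 𝓕⁻ (fun ξ => (m t ξ : ℂ) * H ξ) x) := by
  have h1 : Measurable fun z : (𝔼 n × ℝ) × 𝔼 n => m z.1.2 z.2 :=
    hm.comp (measurable_fst.snd.prodMk measurable_snd)
  have h2 : Measurable fun z : (𝔼 n × ℝ) × 𝔼 n =>
      Complex.exp (((2 * Real.pi * inner ℝ z.2 z.1.1 : ℝ) : ℂ) * Complex.I) • ((m z.1.2 z.2 : ℂ) * H z.2) := by
    fun_prop
  have h3 := h2.stronglyMeasurable.integral_prod_right' (ν := volume)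
  simp_rw [Real.fourierInv_eq']
  exact h3.measurable

/-- The fractional Laplacian of a Schwartz function is integrable. The symbol `|ξ|^{2r}` is a
superposition of dilates of a cutoff of `|ξ|^{2k}`, `k > r`. The `L¹` norm of the piece at scale `τ`
is `O(τ^{-2r-1})` for `τ ≥ 1` and, since `Δ^k g` is integrable, `O(τ^{2k-2r-1})` for `τ ≤ 1`. -/
theorem lintegral_enorm_fracLaplacian_lt_top {n : ℕ} (hn : 0 < n) {r : ℝ} (hr : 0 < r)
    (g : 𝓢(𝔼 n, ℂ)) : ∫⁻ x, ‖fracLaplacian r g x‖ₑ < ∞ := by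
  have : Nonempty (Fin n) := ⟨⟨0, hn⟩⟩
  have hpi := Real.pi_pos
  have hx0 : ∀ᵐ x : 𝔼 n, x ≠ 0 := by simp [ae_iff]
  have hρ := Real.smoothTransition.continuous.measurable
  obtain ⟨k, hk⟩ := exists_nat_gt r
  obtain ⟨A, hA, hAeq⟩ := exists_moment_cutoff (c := 2 * k - 2 * r) (by linarith)
  set c₀ : ℝ := A⁻¹ * (4 * Real.pi ^ 2) ^ r with hc₀
  have hc₀0 : 0 < c₀ := by positivity
  set m : ℝ → 𝔼 n → ℝ := fun τ ξ => c₀ * τ ^ (-(2 * r) - 1) *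
    (((τ * ‖ξ‖) ^ 2) ^ k * Real.smoothTransition (1 - (τ * ‖ξ‖) ^ 2)) with hm
  have hmm : Measurable (Function.uncurry m) := by
    unfold Function.uncurry
    fun_prop
  have hgm : Measurable (𝓕 (g : 𝔼 n → ℂ)) := by
    rw [← SchwartzMap.fourier_coe]; exact (𝓕 g).continuous.measurable
  have hm0 : ∀ t ∈ Ioi (0 : ℝ), ∀ ξ, 0 ≤ m t ξ := fun t ht ξ => by
    have ht0 : (0 : ℝ) < t := ht
    have := Real.smoothTransition.nonneg (1 - (t * ‖ξ‖) ^ 2)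
    positivity
  -- `|ξ|^{2r}` as a superposition over the scales `t`, by the substitution `σ = t |ξ|`
  have hpoint : ∀ x, ‖fracLaplacian r g x‖ₑ ≤
      ∫⁻ t in Ioi (0 : ℝ), ‖𝓕⁻ (fun ξ => (m t ξ : ℂ) * 𝓕 (g : 𝔼 n → ℂ) ξ) x‖ₑ := by
    refine enorm_fourierInv_le_lintegral hmm hm0 (fun ξ => by positivity) ?_ hgm
      (integrable_symbol hn hr.le g)
    filter_upwards [hx0] with ξ hξ
    have hξ' : 0 < ‖ξ‖ := norm_pos_iff.2 hξ
    calc _ = ∫⁻ t in Ioi (0 : ℝ), ENNReal.ofReal (c₀ * ‖ξ‖ ^ (2 * r + 1)) *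
          ENNReal.ofReal ((‖ξ‖ * t) ^ ((2 * k - 2 * r) - 1) *
            Real.smoothTransition (1 - (‖ξ‖ * t) ^ 2)) := by
          refine setLIntegral_congr_fun measurableSet_Ioi fun t ht => ?_
          have ht0 : (0 : ℝ) < t := ht
          rw [← ENNReal.ofReal_mul (by positivity)]
          congr 1
          simp only [hm]
          have e1 : (‖ξ‖ * t) ^ ((2 * k - 2 * r) - 1) =
              (‖ξ‖ ^ (2 * r + 1))⁻¹ * t ^ (-(2 * r) - 1) * ((‖ξ‖ * t) ^ 2) ^ k := by
            rw [show (2 * (k : ℝ) - 2 * r) - 1 = (-(2 * r) - 1) + (2 : ℕ) * k by push_cast; ring,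
              Real.rpow_add (by positivity), Real.rpow_natCast_mul (by positivity),
              Real.rpow_natCast, Real.mul_rpow hξ'.le ht0.le, ← Real.rpow_neg hξ'.le,
              show -(2 * r + 1) = -(2 * r) - 1 by ring]
          have e2 : ‖ξ‖ ^ (2 * r + 1) ≠ 0 := by positivity
          rw [e1, mul_comm t ‖ξ‖]
          generalize ((‖ξ‖ * t) ^ 2) ^ k = Y
          generalize ‖ξ‖ ^ (2 * r + 1) = X at e2 ⊢
          field_simp
      _ = _ := by
          rw [lintegral_const_mul _ (by fun_prop),
            Real.rpow_add_one hξ'.ne', ← mul_assoc, ENNReal.ofReal_mul (by positivity), mul_assoc,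
            lintegral_Ioi_comp_mul (fun s => ENNReal.ofReal (s ^ ((2 * k - 2 * r) - 1) *
              Real.smoothTransition (1 - s ^ 2))) hξ', hAeq, ← ENNReal.ofReal_mul (by positivity),
            Real.mul_rpow (by positivity) (by positivity), ← Real.rpow_natCast_mul hξ'.le]
          congr 1
          rw [hc₀]
          push_cast
          field_simp
  set M : ℝ≥0∞ := (∫⁻ x, ‖𝓕⁻ (cutoffPow n k : 𝔼 n → ℂ) x‖ₑ) * ∫⁻ x, ‖g x‖ₑ with hM
  have hMfin : M < ∞ := ENNReal.mul_lt_top (lintegral_enorm_fourierInv_lt_top _) g.integrable.2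
  -- the Schwartz function whose Fourier transform is `|ξ|^{2k} ĝ`
  set G : 𝓢(𝔼 n, ℂ) := ((-(4 * Real.pi ^ 2 : ℝ) : ℂ) ^ k)⁻¹ • Laplacian.laplacian^[k] g with hG
  set N : ℝ≥0∞ := (∫⁻ x, ‖𝓕⁻ (cutoffPow n 0 : 𝔼 n → ℂ) x‖ₑ) * ∫⁻ x, ‖G x‖ₑ with hN
  have hNfin : N < ∞ := ENNReal.mul_lt_top (lintegral_enorm_fourierInv_lt_top _) G.integrable.2
  have hGF : ∀ ξ, 𝓕 (G : 𝔼 n → ℂ) ξ = ((‖ξ‖ ^ 2) ^ k : ℝ) * 𝓕 (g : 𝔼 n → ℂ) ξ := by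
    intro ξ
    have hne : (-(4 * Real.pi ^ 2 : ℝ) : ℂ) ≠ 0 :=
      neg_ne_zero.2 (Complex.ofReal_ne_zero.2 (by positivity))
    rw [← SchwartzMap.fourier_coe, hG, FourierTransform.fourier_smul, smul_apply,
      fourier_iterate_laplacian_apply, SchwartzMap.fourier_coe, smul_eq_mul,
      Complex.ofReal_mul (4 * Real.pi ^ 2), ← neg_mul, mul_pow, ← mul_assoc, ← mul_assoc,
      inv_mul_cancel₀ (pow_ne_zero _ hne), one_mul, Complex.ofReal_pow (‖ξ‖ ^ 2)]
  have hlarge : ∀ τ : ℝ, 0 < τ →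
      ∫⁻ x, ‖𝓕⁻ (fun ξ => (m τ ξ : ℂ) * 𝓕 (g : 𝔼 n → ℂ) ξ) x‖ₑ ≤
        ENNReal.ofReal (c₀ * τ ^ (-(2 * r) - 1)) * M := by
    intro τ hτ
    have e : (fun ξ => (m τ ξ : ℂ) * 𝓕 (g : 𝔼 n → ℂ) ξ) = fun ξ =>
        ((c₀ * τ ^ (-(2 * r) - 1) : ℝ) : ℂ) * (cutoffPow n k (τ • ξ) * 𝓕 (g : 𝔼 n → ℂ) ξ) := by
      ext ξ
      rw [cutoffPow_apply, norm_smul, Real.norm_of_nonneg hτ.le, ← mul_assoc, ← Complex.ofReal_mul]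
    simp_rw [e, fourierInv_const_mul, enorm_mul]
    rw [lintegral_const_mul' _ _ enorm_ne_top, ← ofReal_norm (_ : ℂ), Complex.norm_real,
      Real.norm_of_nonneg (by positivity)]
    exact mul_le_mul_right (lintegral_enorm_fourierInv_comp_smul_mul_le _ g hτ) _
  have hsmall : ∀ τ : ℝ, 0 < τ →
      ∫⁻ x, ‖𝓕⁻ (fun ξ => (m τ ξ : ℂ) * 𝓕 (g : 𝔼 n → ℂ) ξ) x‖ₑ ≤
        ENNReal.ofReal (c₀ * τ ^ ((2 * k - 2 * r) - 1)) * N := by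
    intro τ hτ
    have e : (fun ξ => (m τ ξ : ℂ) * 𝓕 (g : 𝔼 n → ℂ) ξ) = fun ξ =>
        ((c₀ * τ ^ ((2 * k - 2 * r) - 1) : ℝ) : ℂ) *
          (cutoffPow n 0 (τ • ξ) * 𝓕 (G : 𝔼 n → ℂ) ξ) := by
      ext ξ
      rw [cutoffPow_apply, norm_smul, Real.norm_of_nonneg hτ.le, hGF, ← mul_assoc, ← mul_assoc,
        ← Complex.ofReal_mul, ← Complex.ofReal_mul]
      congr 2
      simp only [hm]
      rw [show (2 * (k : ℝ) - 2 * r) - 1 = (-(2 * r) - 1) + (2 : ℕ) * k by push_cast; ring,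
        Real.rpow_add hτ, Real.rpow_natCast_mul hτ.le, Real.rpow_natCast]
      ring
    simp_rw [e, fourierInv_const_mul, enorm_mul]
    rw [lintegral_const_mul' _ _ enorm_ne_top, ← ofReal_norm (_ : ℂ), Complex.norm_real,
      Real.norm_of_nonneg (by positivity)]
    exact mul_le_mul_right (lintegral_enorm_fourierInv_comp_smul_mul_le _ G hτ) _
  calc ∫⁻ x, ‖fracLaplacian r g x‖ₑ
      ≤ ∫⁻ x, ∫⁻ t in Ioi (0 : ℝ), ‖𝓕⁻ (fun ξ => (m t ξ : ℂ) * 𝓕 (g : 𝔼 n → ℂ) ξ) x‖ₑ :=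
        lintegral_mono hpoint
    _ = ∫⁻ t in Ioi (0 : ℝ), ∫⁻ x, ‖𝓕⁻ (fun ξ => (m t ξ : ℂ) * 𝓕 (g : 𝔼 n → ℂ) ξ) x‖ₑ :=
        lintegral_lintegral_swap (measurable_fourierInv_mul hmm hgm).enorm.aemeasurable
    _ ≤ (∫⁻ t in Ioc (0 : ℝ) 1, ∫⁻ x, ‖𝓕⁻ (fun ξ => (m t ξ : ℂ) * 𝓕 (g : 𝔼 n → ℂ) ξ) x‖ₑ) +
        ∫⁻ t in Ioi (1 : ℝ), ∫⁻ x, ‖𝓕⁻ (fun ξ => (m t ξ : ℂ) * 𝓕 (g : 𝔼 n → ℂ) ξ) x‖ₑ := by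
        rw [← Ioc_union_Ioi_eq_Ioi zero_le_one]
        exact lintegral_union_le _ _ _
    _ ≤ (∫⁻ t in Ioc (0 : ℝ) 1, ENNReal.ofReal (c₀ * t ^ ((2 * k - 2 * r) - 1)) * N) +
        ∫⁻ t in Ioi (1 : ℝ), ENNReal.ofReal (c₀ * t ^ (-(2 * r) - 1)) * M :=
        add_le_add (setLIntegral_mono' measurableSet_Ioc fun t ht => hsmall t ht.1)
          (setLIntegral_mono' measurableSet_Ioi fun t ht => hlarge t (zero_lt_one.trans ht))
    _ < ∞ := by
        have h1 : IntegrableOn (fun t : ℝ => c₀ * t ^ ((2 * k - 2 * r) - 1)) (Ioc 0 1) :=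
          ((intervalIntegrable_iff_integrableOn_Ioc_of_le zero_le_one).1
            (intervalIntegral.intervalIntegrable_rpow' (by linarith))).const_mul c₀
        have h2 : IntegrableOn (fun t : ℝ => c₀ * t ^ (-(2 * r) - 1)) (Ioi 1) :=
          (integrableOn_Ioi_rpow_of_lt (by linarith) one_pos).const_mul c₀
        rw [lintegral_mul_const _ (by fun_prop), lintegral_mul_const _ (by fun_prop)]
        exact ENNReal.add_lt_top.2 ⟨ENNReal.mul_lt_top h1.lintegral_lt_top hNfin,
          ENNReal.mul_lt_top h2.lintegral_lt_top hMfin⟩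

/-- An integrable function, multiplied by `|x|^σ` with `σ < n`, comes arbitrarily close to `0` along
almost every ray, since `∫ |t x|^σ |F(t x)| dt / t` converges for almost every `x`. -/
theorem ae_frequently_norm_rpow_smul_lt {n : ℕ} (hn : 0 < n) {F : 𝔼 n → ℂ} (hF : Measurable F)
    (hint : ∫⁻ x, ‖F x‖ₑ < ∞) {σ : ℝ} (hσ : σ < n) :
    ∀ᵐ x : 𝔼 n, ∀ ε > 0, ∃ᶠ t : ℝ in atTop, ‖powWeight σ (t • x) • F (t • x)‖ < ε := by
  have : Nonempty (Fin n) := ⟨⟨0, hn⟩⟩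
  have hx0 : ∀ᵐ x : 𝔼 n, x ≠ 0 := by simp [ae_iff]
  have hfin : ∫⁻ x : 𝔼 n, ∫⁻ t in Ioi (1 : ℝ), ENNReal.ofReal (t ^ (σ - 1)) * ‖F (t • x)‖ₑ < ∞ := by
    rw [lintegral_lintegral_swap (by unfold Function.uncurry; fun_prop)]
    have : ∀ t ∈ Ioi (1 : ℝ), ∫⁻ x : 𝔼 n, ENNReal.ofReal (t ^ (σ - 1)) * ‖F (t • x)‖ₑ =
        ENNReal.ofReal (t ^ (-(n - σ + 1))) * ∫⁻ x, ‖F x‖ₑ := by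
      intro t ht
      have ht0 : (0 : ℝ) < t := zero_lt_one.trans ht
      rw [lintegral_const_mul _ (by fun_prop), lintegral_comp_smul (fun x => ‖F x‖ₑ) ht0,
        ← mul_assoc, ← ENNReal.ofReal_mul (by positivity), ← Real.rpow_add ht0]
      congr 3
      ring
    rw [setLIntegral_congr_fun measurableSet_Ioi this, lintegral_mul_const _ (by fun_prop),
      lintegral_Ioi_one_rpow_neg (by linarith)]
    exact ENNReal.mul_lt_top ENNReal.ofReal_lt_top hint
  have hae := ae_lt_top (by
    refine Measurable.lintegral_prod_right ?_
    unfold Function.uncurry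
    fun_prop) hfin.ne
  filter_upwards [hae, hx0] with x hx hx0 ε hε hnot
  have hx' : 0 < ‖x‖ := norm_pos_iff.2 hx0
  obtain ⟨T, hT⟩ := eventually_atTop.1 hnot
  set S := max T 1 with hS
  have hint1 : IntegrableOn (fun t : ℝ => t ^ (σ - 1) * ‖F (t • x)‖) (Ioi S) := by
    refine IntegrableOn.mono_set (t := Ioi 1) ⟨?_, ?_⟩ (Ioi_subset_Ioi (le_max_right _ _))
    · exact Measurable.aestronglyMeasurable (by fun_prop)
    · rw [hasFiniteIntegral_iff_enorm]
      refine lt_of_le_of_lt (le_of_eq ?_) hx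
      refine setLIntegral_congr_fun measurableSet_Ioi fun t ht => ?_
      have ht0 : (0 : ℝ) < t := zero_lt_one.trans ht
      rw [enorm_mul, enorm_norm, ← ofReal_norm (t ^ (σ - 1)), Real.norm_of_nonneg (by positivity)]
  -- otherwise `t⁻¹` would be dominated near infinity by an integrable function
  refine not_integrableOn_Ioi_inv (a := S) ?_
  refine ((hint1.const_mul (‖x‖ ^ σ / ε))).mono' (Measurable.aestronglyMeasurable (by fun_prop)) ?_
  filter_upwards [ae_restrict_mem measurableSet_Ioi] with t ht
  have htS : S < t := ht
  have ht0 : 0 < t := zero_lt_one.trans ((le_max_right T 1).trans_lt htS)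
  have hle := hT t ((le_max_left T 1).trans htS.le)
  rw [not_lt, powWeight, norm_smul, norm_smul, Real.norm_of_nonneg ht0.le,
    Real.norm_of_nonneg (by positivity), Real.mul_rpow ht0.le hx'.le] at hle
  rw [Real.norm_of_nonneg (by positivity), Real.rpow_sub_one ht0.ne']
  calc t⁻¹ = ε / (ε * t) := by field_simp
    _ ≤ (t ^ σ * ‖x‖ ^ σ * ‖F (t • x)‖) / (ε * t) := by gcongr
    _ = _ := by field_simp

/-! ### Gradient bounds for weighted potentials -/

theorem eLpNorm_le_of_lintegral_rpow_le {n : ℕ} {E F : Type*} [NormedAddCommGroup E]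
    [NormedAddCommGroup F] {p C : ℝ} (hp : 0 < p) {f : 𝔼 n → E} {g : 𝔼 n → F}
    (h : ∫⁻ x, ‖f x‖ₑ ^ p ≤ ENNReal.ofReal C ^ p * ∫⁻ x, ‖g x‖ₑ ^ p) :
    eLpNorm f (ENNReal.ofReal p) volume ≤
      ENNReal.ofReal C * eLpNorm g (ENNReal.ofReal p) volume := by
  have hp0 : ENNReal.ofReal p ≠ 0 := by simpa using hp
  rw [eLpNorm_eq_lintegral_rpow_enorm_toReal hp0 ENNReal.ofReal_ne_top,
    eLpNorm_eq_lintegral_rpow_enorm_toReal hp0 ENNReal.ofReal_ne_top, ENNReal.toReal_ofReal hp.le]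
  refine (ENNReal.rpow_le_rpow h (by positivity)).trans (le_of_eq ?_)
  rw [ENNReal.mul_rpow_of_nonneg _ _ (by positivity), ← ENNReal.rpow_mul,
    mul_one_div_cancel hp.ne', ENNReal.rpow_one]

theorem enorm_powWeight_mul_gradNorm {n : ℕ} (β : ℝ) (f : 𝔼 n → ℂ) (x : 𝔼 n) :
    ‖powWeight β x * gradNorm f x‖ₑ = ENNReal.ofReal (‖x‖ ^ β * gradNorm f x) := by
  have := gradNorm_nonneg f x
  rw [← ofReal_norm, powWeight, Real.norm_of_nonneg (by positivity)]

theorem enorm_powWeight_smul {n : ℕ} (a : ℝ) (x : 𝔼 n) (z : ℂ) :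
    ‖powWeight a x • z‖ₑ = ENNReal.ofReal (‖x‖ ^ a) * ‖z‖ₑ := by
  rw [enorm_smul, ← ofReal_norm, powWeight, Real.norm_of_nonneg (by positivity)]

theorem steinWeissGradConst_eq (n : ℕ) {p q lam α β σ : ℝ} (hpq : 1 / p + 1 / q = 1)
    (hsum : (n : ℝ) + 1 = lam + α + β + σ) : steinWeissGradConst n p q α β σ =
      rieszCompositionConst n lam (β + σ - 1 + n / p) * ((n : ℝ) / p + β - 1)⁻¹ := by
  have h1 : (n : ℝ) / p + n / q = n := by
    rw [div_eq_mul_one_div, div_eq_mul_one_div (n : ℝ) q, ← mul_add, hpq, mul_one]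
  have hd : ∀ s : ℝ, (n : ℝ) / (2 * s) = n / s / 2 := fun s => by rw [mul_comm, div_div]
  unfold steinWeissGradConst rieszCompositionConst
  rw [hd, hd, show (α + β + σ - 1) / 2 = (n - lam) / 2 by linarith,
    show (n + 1 - α - β - σ) / 2 = lam / 2 by linarith,
    show (n : ℝ) / p / 2 - α / 2 = (lam + (β + σ - 1 + n / p) - n) / 2 by linarith,
    show (n : ℝ) / q / 2 - (β + σ - 1) / 2 = (n - (β + σ - 1 + n / p)) / 2 by linarith,
    show (n : ℝ) / q / 2 + α / 2 = (2 * n - lam - (β + σ - 1 + n / p)) / 2 by linarith,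
    show (n : ℝ) / p / 2 + (β + σ - 1) / 2 = (β + σ - 1 + n / p) / 2 by linarith]
  ring

/-- The Stein-Weiss inequality for the density `|x|^{β-1} |f|`. -/
theorem lintegral_steinWeiss_rpow_le {n : ℕ} {p q lam α β σ : ℝ} (hp : 1 < p)
    (hpq : 1 / p + 1 / q = 1) (hlam : 0 < lam) (hlamn : lam < n) (hα : α < n / p)
    (hβσ : β + σ - 1 < n / q) (hsum : (n : ℝ) + 1 = lam + α + β + σ) {f : 𝔼 n → ℂ}
    (hf : Measurable f) :
    ∫⁻ x : 𝔼 n, (∫⁻ y : 𝔼 n,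
        ENNReal.ofReal (‖x‖ ^ (-α) * ‖x - y‖ ^ (-lam) * ‖y‖ ^ (-σ)) * ‖f y‖ₑ) ^ p ≤
      ENNReal.ofReal (rieszCompositionConst n lam (β + σ - 1 + n / p)) ^ p *
        ∫⁻ y : 𝔼 n, ENNReal.ofReal (‖y‖ ^ (β - 1) * ‖f y‖) ^ p := by
  have hn : 0 < n := by exact_mod_cast hlam.trans hlamn
  have : Nonempty (Fin n) := ⟨⟨0, hn⟩⟩
  have hx0 : ∀ᵐ x : 𝔼 n, x ≠ 0 := by simp [ae_iff]
  have hpq' : p.HolderConjugate q := Real.holderConjugate_iff.2 ⟨hp, by simpa using hpq⟩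
  have h := lintegral_steinWeiss_le hpq' hlam hlamn hα hβσ (by linarith)
    (h := fun y => ENNReal.ofReal (‖y‖ ^ (β - 1) * ‖f y‖)) (by fun_prop)
  refine le_trans (le_of_eq ?_) h
  refine lintegral_congr fun x => ?_
  congr 1
  refine lintegral_congr_ae ?_
  filter_upwards [hx0] with y hy
  have hy' : 0 < ‖y‖ := norm_pos_iff.2 hy
  rw [← ofReal_norm, ← ENNReal.ofReal_mul (by positivity), ← ENNReal.ofReal_mul (by positivity)]
  congr 1
  rw [show -σ = -(β + σ - 1) + (β - 1) by ring, Real.rpow_add hy']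
  ring

/-- The composition of the Stein-Weiss and Hardy inequalities. -/
theorem lintegral_steinWeiss_gradNorm_le {n : ℕ} {p q lam α β σ : ℝ} (hp : 1 < p)
    (hpq : 1 / p + 1 / q = 1) (hlam : 0 < lam) (hlamn : lam < n) (hα : α < n / p)
    (hβ : 1 - n / p < β) (hβσ : β + σ - 1 < n / q) (hsum : (n : ℝ) + 1 = lam + α + β + σ)
    {f : 𝔼 n → ℂ} (hfm : Measurable f) (hf : ContDiffOn ℝ 1 f {0}ᶜ)
    (hdecay : ∀ᵐ x : 𝔼 n, ∀ ε > 0, ∃ᶠ t : ℝ in atTop, ‖f (t • x)‖ < ε) :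
    ∫⁻ x : 𝔼 n, (∫⁻ y : 𝔼 n,
        ENNReal.ofReal (‖x‖ ^ (-α) * ‖x - y‖ ^ (-lam) * ‖y‖ ^ (-σ)) * ‖f y‖ₑ) ^ p ≤
      ENNReal.ofReal (steinWeissGradConst n p q α β σ) ^ p *
        ∫⁻ x : 𝔼 n, ENNReal.ofReal (‖x‖ ^ β * gradNorm f x) ^ p := by
  have hn : 0 < n := by exact_mod_cast hlam.trans hlamn
  have hinv : 0 ≤ ((n : ℝ) / p + β - 1)⁻¹ := inv_nonneg.2 (by linarith)
  refine (lintegral_steinWeiss_rpow_le hp hpq hlam hlamn hα hβσ hsum hfm).trans ?_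
  rw [steinWeissGradConst_eq n hpq hsum, ENNReal.ofReal_mul' hinv,
    ENNReal.mul_rpow_of_nonneg _ _ (by linarith), mul_assoc]
  exact mul_le_mul_right (lintegral_hardy_le hn hp hβ hf hdecay) _

theorem frequently_norm_schwartz_lt {n : ℕ} (f : 𝓢(𝔼 n, ℂ)) {x : 𝔼 n} (hx : x ≠ 0) :
    ∀ ε > 0, ∃ᶠ t : ℝ in atTop, ‖f (t • x)‖ < ε := by
  intro ε hε
  obtain ⟨C, hC0, hC⟩ := f.decay 1 0
  simp only [norm_iteratedFDeriv_zero, pow_one] at hC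
  have hx' : 0 < ‖x‖ := norm_pos_iff.2 hx
  refine Eventually.frequently ?_
  filter_upwards [eventually_gt_atTop (C / (‖x‖ * ε)), eventually_gt_atTop 0] with t ht ht0
  have h1 := hC (t • x)
  rw [norm_smul, Real.norm_of_nonneg ht0.le] at h1
  rw [div_lt_iff₀ (by positivity)] at ht
  by_contra hcon
  rw [not_lt] at hcon
  have : t * ‖x‖ * ε ≤ t * ‖x‖ * ‖f (t • x)‖ := by gcongr
  nlinarith

/-- The local integrability of `|x|^{(β-1)p}` makes `|x|^{β-1} f` an `L^p` function. -/
theorem lintegral_norm_rpow_mul_norm_rpow_lt_top {n : ℕ} (hn : 0 < n) {p β : ℝ} (hp : 1 < p)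
    (hβ : 1 - n / p < β) (f : 𝓢(𝔼 n, ℂ)) :
    ∫⁻ y : 𝔼 n, ENNReal.ofReal (‖y‖ ^ (β - 1) * ‖f y‖) ^ p < ∞ := by
  have hp0 : 0 < p := by linarith
  obtain ⟨C, hC0, hC⟩ := f.decay 0 0
  simp only [norm_iteratedFDeriv_zero, pow_zero, one_mul] at hC
  have hs : -(n : ℝ) < (β - 1) * p := by
    have : -(n / p) * p < (β - 1) * p := by gcongr; linarith
    rwa [neg_mul, div_mul_cancel₀ _ hp0.ne'] at this
  refine lt_of_le_of_lt ?_ ((integrable_norm_rpow_mul_norm hn hs f).const_mul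
    (C ^ (p - 1))).lintegral_lt_top
  refine lintegral_mono fun y => ?_
  rw [ENNReal.ofReal_rpow_of_nonneg (by positivity) hp0.le]
  refine ENNReal.ofReal_le_ofReal ?_
  rw [Real.mul_rpow (by positivity) (by positivity), ← Real.rpow_mul (by positivity)]
  have h1 : ‖f y‖ ^ p ≤ C ^ (p - 1) * ‖f y‖ := by
    rcases eq_or_lt_of_le (norm_nonneg (f y)) with h0 | h0
    · rw [← h0, Real.zero_rpow hp0.ne', mul_zero]
    · calc ‖f y‖ ^ p = ‖f y‖ ^ (p - 1) * ‖f y‖ := by rw [← Real.rpow_add_one h0.ne', sub_add_cancel]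
        _ ≤ _ := mul_le_mul_of_nonneg_right
            (Real.rpow_le_rpow h0.le (hC y) (by linarith)) h0.le
  calc _ ≤ ‖y‖ ^ ((β - 1) * p) * (C ^ (p - 1) * ‖f y‖) := by gcongr
    _ = _ := by ring

theorem lintegral_convolution_kernel_eq {n : ℕ} (lam σ α : ℝ) (f : 𝔼 n → ℂ) (x : 𝔼 n) :
    ENNReal.ofReal (‖x‖ ^ (-α)) * ∫⁻ t : 𝔼 n, ‖ContinuousLinearMap.lsmul ℝ ℝ (powWeight (-lam) t)
        (powWeight (-σ) (x - t) • f (x - t))‖ₑ =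
      ∫⁻ y : 𝔼 n, ENNReal.ofReal (‖x‖ ^ (-α) * ‖x - y‖ ^ (-lam) * ‖y‖ ^ (-σ)) * ‖f y‖ₑ := by
  rw [← lintegral_sub_left_eq_self (fun y : 𝔼 n =>
    ENNReal.ofReal (‖x‖ ^ (-α) * ‖x - y‖ ^ (-lam) * ‖y‖ ^ (-σ)) * ‖f y‖ₑ) x,
    ← lintegral_const_mul' _ _ ENNReal.ofReal_ne_top]
  refine lintegral_congr fun t => ?_
  rw [ContinuousLinearMap.lsmul_apply, enorm_powWeight_smul, enorm_powWeight_smul, sub_sub_cancel,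
    ← mul_assoc, ← mul_assoc, ← ENNReal.ofReal_mul (by positivity),
    ← ENNReal.ofReal_mul (by positivity)]

/-- The Stein-Weiss estimate with gradient for Schwartz functions. The convolution exists at almost
every point because the left-hand side of the Stein-Weiss inequality is finite. -/
theorem steinWeiss_gradNorm {n : ℕ} {p q lam α β σ : ℝ} (hp : 1 < p)
    (hpq : 1 / p + 1 / q = 1) (hlam : 0 < lam) (hlamn : lam < n) (hα : α < n / p)
    (hβ : 1 - n / p < β) (hβσ : β + σ - 1 < n / q) (hsum : (n : ℝ) + 1 = lam + α + β + σ)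
    (f : 𝓢(𝔼 n, ℂ)) :
    (∀ᵐ x : 𝔼 n, ConvolutionExistsAt (powWeight (-lam))
      (fun y => powWeight (-σ) y • f y) x (ContinuousLinearMap.lsmul ℝ ℝ) volume) ∧
    eLpNorm (fun x : 𝔼 n => powWeight (-α) x • (powWeight (-lam)
        ⋆[ContinuousLinearMap.lsmul ℝ ℝ, volume] (fun y => powWeight (-σ) y • f y)) x)
        (ENNReal.ofReal p) volume
      ≤ ENNReal.ofReal (steinWeissGradConst n p q α β σ) *
        eLpNorm (fun x : 𝔼 n => powWeight β x * gradNorm f x) (ENNReal.ofReal p) volume := by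
  have hn : 0 < n := by exact_mod_cast hlam.trans hlamn
  have hp0 : 0 < p := by linarith
  have : Nonempty (Fin n) := ⟨⟨0, hn⟩⟩
  have hx0 : ∀ᵐ x : 𝔼 n, x ≠ 0 := by simp [ae_iff]
  have hfm := f.continuous.measurable
  constructor
  · have hfin : ∫⁻ x : 𝔼 n, (∫⁻ y : 𝔼 n,
        ENNReal.ofReal (‖x‖ ^ (-α) * ‖x - y‖ ^ (-lam) * ‖y‖ ^ (-σ)) * ‖f y‖ₑ) ^ p < ∞ :=
      (lintegral_steinWeiss_rpow_le hp hpq hlam hlamn hα hβσ hsum hfm).trans_lt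
        (ENNReal.mul_lt_top (ENNReal.rpow_lt_top_of_nonneg hp0.le ENNReal.ofReal_ne_top)
          (lintegral_norm_rpow_mul_norm_rpow_lt_top hn hp hβ f))
    have hae := ae_lt_top (by
      refine Measurable.pow_const (Measurable.lintegral_prod_right ?_) p
      unfold Function.uncurry
      fun_prop) hfin.ne
    filter_upwards [hae, hx0] with x hx hx0
    have hx' : 0 < ‖x‖ := norm_pos_iff.2 hx0
    rw [ENNReal.rpow_lt_top_iff_of_pos hp0, ← lintegral_convolution_kernel_eq lam σ α f x] at hx
    refine ⟨?_, ?_⟩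
    · refine Measurable.aestronglyMeasurable ?_
      simp only [ContinuousLinearMap.lsmul_apply, powWeight]
      fun_prop
    · refine ENNReal.lt_top_of_mul_ne_top_right hx.ne ?_
      simp only [ne_eq, ENNReal.ofReal_eq_zero, not_le]
      positivity
  · refine eLpNorm_le_of_lintegral_rpow_le hp0 ?_
    simp_rw [enorm_powWeight_mul_gradNorm]
    refine le_trans (lintegral_mono fun x => ?_) (lintegral_steinWeiss_gradNorm_le hp hpq hlam hlamn
      hα hβ hβσ hsum hfm (f.smooth 1).contDiffOn
      (hx0.mono fun x hx => frequently_norm_schwartz_lt f hx))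
    refine ENNReal.rpow_le_rpow ?_ hp0.le
    rw [enorm_powWeight_smul, ← lintegral_convolution_kernel_eq lam σ α f x]
    exact mul_le_mul_right (enorm_integral_le_lintegral_enorm _) _

/-- The Hardy-Rellich estimate: the Stein-Weiss and Hardy inequalities, applied to
`f = |x|^σ (-Δ)^r g`, bound the Riesz potential that dominates `g`. -/
theorem hardyRellich_gradNorm {n : ℕ} {p q lam α β σ : ℝ} (hp : 1 < p)
    (hpq : 1 / p + 1 / q = 1) (hlam : 0 < lam) (hlamn : lam < n) (hα : α < n / p)
    (hβ : 1 - n / p < β) (hβσ : β + σ - 1 < n / q) (hsum : (n : ℝ) + 1 = lam + α + β + σ)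
    (g : 𝓢(𝔼 n, ℂ)) :
    ∫⁻ x : 𝔼 n, ‖powWeight (-α) x • g x‖ₑ ^ p ≤
      ENNReal.ofReal (hardyRellichGradConst n p q α β σ) ^ p *
        ∫⁻ x : 𝔼 n, ‖powWeight β x * gradNorm (fun y => powWeight σ y •
          fracLaplacian ((α + β + σ - 1) / 2) g y) x‖ₑ ^ p := by
  have hn0 : (0 : ℝ) < n := hlam.trans hlamn
  have hn : 0 < n := by exact_mod_cast hn0
  have hp0 : 0 < p := by linarith
  have hpi := Real.pi_pos
  have : Nonempty (Fin n) := ⟨⟨0, hn⟩⟩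
  have hx0 : ∀ᵐ x : 𝔼 n, x ≠ 0 := by simp [ae_iff]
  set r : ℝ := (α + β + σ - 1) / 2 with hr
  have hr0 : 0 < r := by rw [hr]; linarith
  have hrn : 2 * r < n := by rw [hr]; linarith
  have hGr := Real.Gamma_pos_of_pos hr0
  have hGr2 : 0 < Real.Gamma (n / 2 - r) := Real.Gamma_pos_of_pos (by linarith)
  set F := fracLaplacian r g with hF
  have hFc : ContDiff ℝ 1 F := contDiff_fracLaplacian hn hr0.le g
  have hFm : Measurable F := hFc.continuous.measurable
  set f : 𝔼 n → ℂ := fun y => powWeight σ y • F y with hf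
  have hfm : Measurable f := by
    simp only [hf, powWeight]
    fun_prop
  -- `β > 1 - n / p` and `β + σ - 1 < n / q` force `σ < n`
  have hσ : σ < n := by
    have : (n : ℝ) / p + n / q = n := by
      rw [div_eq_mul_one_div, div_eq_mul_one_div (n : ℝ) q, ← mul_add, hpq, mul_one]
    linarith
  have hfd : ContDiffOn ℝ 1 f {0}ᶜ := by
    intro y hy
    have hy0 : y ≠ 0 := hy
    have h1 : ContDiffAt ℝ 1 (powWeight σ : 𝔼 n → ℝ) y :=
      (contDiffAt_norm ℝ hy0).rpow_const_of_ne (norm_ne_zero_iff.2 hy0)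
    exact (h1.smul hFc.contDiffAt).contDiffWithinAt
  have hmain := lintegral_steinWeiss_gradNorm_le hp hpq hlam hlamn hα hβ hβσ hsum hfm hfd
    (ae_frequently_norm_rpow_smul_lt hn hFm (lintegral_enorm_fracLaplacian_lt_top hn hr0 g) hσ)
  set c : ℝ := Real.Gamma (n / 2 - r) /
    (Real.pi ^ ((n : ℝ) / 2) * 2 ^ (2 * r) * Real.Gamma r) with hc
  have hc0 : 0 ≤ c := by positivity
  have hconst : hardyRellichGradConst n p q α β σ = c * steinWeissGradConst n p q α β σ := by
    unfold hardyRellichGradConst steinWeissGradConst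
    rw [← hr, hc, show (n + 1 - α - β - σ) / 2 = n / 2 - r by rw [hr]; ring,
      show -(α + β + σ - 1) = -(2 * r) by rw [hr]; ring, Real.rpow_neg (by norm_num)]
    generalize Real.Gamma (n / (2 * p) - α / 2) = a₁
    generalize Real.Gamma (n / (2 * q) - (β + σ - 1) / 2) = a₂
    generalize Real.Gamma (n / (2 * q) + α / 2) = a₃
    generalize Real.Gamma (n / (2 * p) + (β + σ - 1) / 2) = a₄
    generalize Real.Gamma (n / 2 - r) = a₅ at hGr2
    generalize (n : ℝ) / p + β - 1 = a₆
    field_simp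
  have hpoint : ∀ x, ‖powWeight (-α) x • g x‖ₑ ≤ ENNReal.ofReal c * ∫⁻ y : 𝔼 n,
      ENNReal.ofReal (‖x‖ ^ (-α) * ‖x - y‖ ^ (-lam) * ‖y‖ ^ (-σ)) * ‖f y‖ₑ := by
    intro x
    rw [enorm_powWeight_smul]
    refine (mul_le_mul_right (enorm_le_lintegral_fracLaplacian hr0 hrn g x) _).trans (le_of_eq ?_)
    rw [mul_left_comm, ← hF, ← lintegral_const_mul _ (by fun_prop)]
    congr 1
    refine lintegral_congr_ae ?_
    filter_upwards [hx0] with y hy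
    have hy' : 0 < ‖y‖ := norm_pos_iff.2 hy
    rw [hf, enorm_powWeight_smul, ← mul_assoc, ← mul_assoc, ← ENNReal.ofReal_mul (by positivity),
      ← ENNReal.ofReal_mul (by positivity)]
    congr 2
    rw [mul_assoc _ (‖y‖ ^ (-σ)), ← Real.rpow_add hy', neg_add_cancel, Real.rpow_zero, mul_one,
      show n - 2 * r = lam by rw [hr]; linarith]
  simp_rw [enorm_powWeight_mul_gradNorm]
  calc _ ≤ ∫⁻ x : 𝔼 n, (ENNReal.ofReal c * ∫⁻ y : 𝔼 n,
        ENNReal.ofReal (‖x‖ ^ (-α) * ‖x - y‖ ^ (-lam) * ‖y‖ ^ (-σ)) * ‖f y‖ₑ) ^ p :=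
        lintegral_mono fun x => ENNReal.rpow_le_rpow (hpoint x) hp0.le
    _ = ENNReal.ofReal c ^ p * ∫⁻ x : 𝔼 n, (∫⁻ y : 𝔼 n,
        ENNReal.ofReal (‖x‖ ^ (-α) * ‖x - y‖ ^ (-lam) * ‖y‖ ^ (-σ)) * ‖f y‖ₑ) ^ p := by
        simp_rw [ENNReal.mul_rpow_of_nonneg _ _ hp0.le]
        exact lintegral_const_mul' _ _ (ENNReal.rpow_ne_top_of_nonneg hp0.le ENNReal.ofReal_ne_top)
    _ ≤ _ := by
        rw [hconst, ENNReal.ofReal_mul hc0, ENNReal.mul_rpow_of_nonneg _ _ hp0.le, mul_assoc]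
        exact mul_le_mul_right hmain _

/-! ### The Davies-Hinz inequality -/

/-- The exponents for which the Davies-Hinz inequality is an instance of the Hardy-Rellich estimate. -/
theorem daviesHinz_exponents {n : ℕ} {p q γ : ℝ} (hp : 1 < p) (hpq : 1 / p + 1 / q = 1) (m : ℕ)
    (hγ : γ + (2 * m + 1) * p < n) (hγ' : -(n * (p - 1)) < γ) :
    γ / p + 2 * m + 1 < n / p ∧ -(γ / p) < n / q ∧ 1 - n / p < -(γ / p) := by
  have hp0 : 0 < p := by linarith
  have hm0 : (0 : ℝ) ≤ m := Nat.cast_nonneg m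
  have hnpq : (n : ℝ) / p + n / q = n := by
    rw [div_eq_mul_one_div, div_eq_mul_one_div (n : ℝ) q, ← mul_add, hpq, mul_one]
  have h1 : γ / p + 2 * m + 1 < n / p := by
    rw [lt_div_iff₀ hp0]
    have : (γ / p + 2 * m + 1) * p = γ + (2 * m + 1) * p := by field_simp; ring
    linarith
  refine ⟨h1, ?_, by linarith⟩
  have : (n : ℝ) / q = n * (p - 1) / p := by
    rw [eq_sub_of_add_eq' hnpq]; field_simp
  rw [this, ← neg_div, div_lt_div_iff_of_pos_right hp0]
  linarith

theorem hardyRellichGradConst_pos {n : ℕ} {p q α β σ : ℝ} (hα : α < n / p) (hβ : 1 - n / p < β)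
    (hβσ : β + σ - 1 < n / q) (h : 0 ≤ α + β + σ - 1) : 0 < hardyRellichGradConst n p q α β σ := by
  have hd : ∀ s : ℝ, (n : ℝ) / (2 * s) = n / s / 2 := fun s => by rw [mul_comm, div_div]
  unfold hardyRellichGradConst
  rw [hd, hd]
  have h1 := Real.Gamma_pos_of_pos (s := n / p / 2 - α / 2) (by linarith)
  have h2 := Real.Gamma_pos_of_pos (s := n / q / 2 - (β + σ - 1) / 2) (by linarith)
  have h3 := Real.Gamma_pos_of_pos (s := n / q / 2 + α / 2) (by linarith)
  have h4 := Real.Gamma_pos_of_pos (s := n / p / 2 + (β + σ - 1) / 2) (by linarith)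
  have h5 : 0 < (n : ℝ) / p + β - 1 := by linarith
  positivity

/-- The factor `n/p + β - 1` of the Hardy inequality is absorbed by `Γ(z + 1) = z Γ(z)`. -/
theorem daviesHinzConst_eq {n : ℕ} {p q γ : ℝ} (hp : 1 < p) (hpq : 1 / p + 1 / q = 1) (m : ℕ)
    (hγ : γ + (2 * m + 1) * p < n) (hγ' : -(n * (p - 1)) < γ) : daviesHinzConst n p q γ m =
      hardyRellichGradConst n p q (γ / p + 2 * m + 1) (-(γ / p)) 0 ^ p := by
  obtain ⟨h1, h2, h3⟩ := daviesHinz_exponents hp hpq m hγ hγ'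
  have hm0 : (0 : ℝ) ≤ m := Nat.cast_nonneg m
  have hd : ∀ s : ℝ, (n : ℝ) / (2 * s) = n / s / 2 := fun s => by rw [mul_comm, div_div]
  set z : ℝ := n / p / 2 + (-(γ / p) + 0 - 1) / 2 with hz
  have hz0 : 0 < z := by rw [hz]; linarith
  have e1 : (n - γ) / (2 * p) - m - 1 / 2 = n / p / 2 - (γ / p + 2 * m + 1) / 2 := by
    rw [sub_div, hd, mul_comm 2 p, ← div_div γ]; ring
  have e2 : n / (2 * q) + γ / (2 * p) + 1 / 2 = n / q / 2 - (-(γ / p) + 0 - 1) / 2 := by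
    rw [hd, mul_comm 2 p, ← div_div γ]; ring
  have e3 : n / (2 * q) + γ / (2 * p) + m + 1 / 2 = n / q / 2 + (γ / p + 2 * m + 1) / 2 := by
    rw [hd, mul_comm 2 p, ← div_div γ]; ring
  have e4 : (n - γ) / (2 * p) + 1 / 2 = z + 1 := by
    rw [hz, sub_div, hd, mul_comm 2 p, ← div_div γ]; ring
  have g1 := Real.Gamma_pos_of_pos (s := n / p / 2 - (γ / p + 2 * m + 1) / 2) (by linarith)
  have g2 := Real.Gamma_pos_of_pos (s := n / q / 2 - (-(γ / p) + 0 - 1) / 2) (by linarith)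
  have g3 := Real.Gamma_pos_of_pos (s := n / q / 2 + (γ / p + 2 * m + 1) / 2) (by linarith)
  have g4 := Real.Gamma_pos_of_pos hz0
  unfold daviesHinzConst hardyRellichGradConst
  rw [e1, e2, e3, e4, Real.Gamma_add_one hz0.ne', hd, hd, ← hz, Real.rpow_mul (by norm_num),
    ← Real.mul_rpow (by positivity) (by positivity)]
  congr 1
  rw [show (n : ℝ) / p + -(γ / p) - 1 = 2 * z by rw [hz]; ring,
    show -(2 * (m : ℝ) + 1) = -(γ / p + 2 * m + 1 + -(γ / p) + 0 - 1) - 1 by ring,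
    Real.rpow_sub_one (by norm_num)]
  field_simp

theorem lintegral_daviesHinz_le {n : ℕ} {p q γ : ℝ} (hp : 1 < p) (hpq : 1 / p + 1 / q = 1) (m : ℕ)
    (hγ : γ + (2 * m + 1) * p < n) (hγ' : -(n * (p - 1)) < γ) (u : 𝓢(𝔼 n, ℂ)) :
    ∫⁻ x : 𝔼 n, ENNReal.ofReal (powWeight (-γ - (2 * m + 1) * p) x * ‖u x‖ ^ p) ≤
      ENNReal.ofReal (daviesHinzConst n p q γ m) *
        ∫⁻ x : 𝔼 n, ENNReal.ofReal (powWeight (-γ) x *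
          gradNorm (Laplacian.laplacian^[m] u) x ^ p) := by
  have hp0 : 0 < p := by linarith
  have hm0 : (0 : ℝ) ≤ m := Nat.cast_nonneg m
  have hn0 : (0 : ℝ) < n := by
    by_contra hcon
    nlinarith
  have hn : 0 < n := by exact_mod_cast hn0
  have : Nonempty (Fin n) := ⟨⟨0, hn⟩⟩
  have hx0 : ∀ᵐ x : 𝔼 n, x ≠ 0 := by simp [ae_iff]
  obtain ⟨hαn, hβn, hβ1⟩ := daviesHinz_exponents hp hpq m hγ hγ'
  have hcpow : ENNReal.ofReal (daviesHinzConst n p q γ m) =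
      ENNReal.ofReal (hardyRellichGradConst n p q (γ / p + 2 * m + 1) (-(γ / p)) 0) ^ p := by
    rw [daviesHinzConst_eq hp hpq m hγ hγ', ENNReal.ofReal_rpow_of_nonneg _ hp0.le]
    exact (hardyRellichGradConst_pos hαn hβ1 (by linarith) (by linarith)).le
  set α : ℝ := γ / p + 2 * m + 1 with hα
  set β : ℝ := -(γ / p) with hβ
  have key : ∫⁻ x : 𝔼 n, ENNReal.ofReal (‖x‖ ^ (-α) * ‖u x‖) ^ p ≤
      ENNReal.ofReal (hardyRellichGradConst n p q α β 0) ^ p *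
        ∫⁻ x : 𝔼 n, ENNReal.ofReal (‖x‖ ^ β * gradNorm (Laplacian.laplacian^[m] u) x) ^ p := by
    -- for `m = 0` the kernel exponent `λ = n - 2m` reaches `n`, and only the Hardy inequality is left
    rcases Nat.eq_zero_or_pos m with rfl | hm
    · have hG1 : 0 < Real.Gamma (n / (2 * p) - α / 2) := Real.Gamma_pos_of_pos (by
        rw [mul_comm, ← div_div]; linarith)
      have hG2 : 0 < Real.Gamma (n / (2 * q) - (β + 0 - 1) / 2) := Real.Gamma_pos_of_pos (by
        rw [mul_comm, ← div_div]; linarith)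
      have hcst : hardyRellichGradConst n p q α β 0 = (n / p + β - 1)⁻¹ := by
        unfold hardyRellichGradConst
        have e0 : α = 1 - β := by rw [hα, hβ]; push_cast; ring
        rw [e0] at hG1 ⊢
        rw [show n / (2 * q) + (1 - β) / 2 = n / (2 * q) - (β + 0 - 1) / 2 by ring,
          show n / (2 * p) + (β + 0 - 1) / 2 = n / (2 * p) - (1 - β) / 2 by ring,
          mul_comm (Real.Gamma (n / (2 * p) - (1 - β) / 2)), div_self (by positivity)]
        simp
      rw [hcst]
      have := lintegral_hardy_le hn hp hβ1 (u.smooth 1).contDiffOn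
        (hx0.mono fun x hx => frequently_norm_schwartz_lt u hx)
      simpa [show -α = β - 1 by rw [hα, hβ]; push_cast; ring] using this
    · have hm1 : (0 : ℝ) < m := by exact_mod_cast hm
      have hnpq : (n : ℝ) / p + n / q = n := by
        rw [div_eq_mul_one_div, div_eq_mul_one_div (n : ℝ) q, ← mul_add, hpq, mul_one]
      have hαβ : α + β = 2 * m + 1 := by rw [hα, hβ]; ring
      have h := hardyRellich_gradNorm (lam := n - 2 * m) (σ := 0) hp hpq (by linarith) (by linarith)
        hαn hβ1 (by linarith) (by rw [hα, hβ]; ring) u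
      have hfl : (fun y : 𝔼 n => powWeight 0 y • fracLaplacian ((α + β + 0 - 1) / 2) u y) =
          fun y => (-1 : ℂ) ^ m * Laplacian.laplacian^[m] (u : 𝔼 n → ℂ) y := by
        rw [show (α + β + 0 - 1) / 2 = (m : ℝ) by rw [hα, hβ]; ring, fracLaplacian_natCast]
        simp [powWeight]
      have hgr : ∀ x : 𝔼 n, gradNorm (fun y : 𝔼 n => (-1 : ℂ) ^ m *
          Laplacian.laplacian^[m] (u : 𝔼 n → ℂ) y) x = gradNorm (Laplacian.laplacian^[m] u) x := by
        intro x
        unfold gradNorm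
        have hdiff : DifferentiableAt ℝ (Laplacian.laplacian^[m] (u : 𝔼 n → ℂ)) x := by
          rw [← coe_iterate_laplacian]
          exact SchwartzMap.differentiableAt _
        rw [fderiv_const_mul hdiff]
        simp
      rw [hfl] at h
      simp_rw [enorm_powWeight_mul_gradNorm, hgr, enorm_powWeight_smul, ← ofReal_norm] at h
      simp_rw [ENNReal.ofReal_mul (Real.rpow_nonneg (norm_nonneg _) _)] at h ⊢
      exact h
  rw [← hcpow] at key
  have hpw : ∀ (s G : ℝ) (x : 𝔼 n), 0 ≤ G →
      ENNReal.ofReal (‖x‖ ^ s * G) ^ p = ENNReal.ofReal (‖x‖ ^ (s * p) * G ^ p) := by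
    intro s G x hG
    rw [ENNReal.ofReal_rpow_of_nonneg (by positivity) hp0.le,
      Real.mul_rpow (by positivity) hG, Real.rpow_mul (norm_nonneg _)]
  simp_rw [hpw _ _ _ (norm_nonneg _), hpw _ _ _ (gradNorm_nonneg _ _)] at key
  have e1 : -α * p = -γ - (2 * m + 1) * p := by rw [hα]; field_simp; ring
  have e2 : β * p = -γ := by rw [hβ]; field_simp
  rw [e1, e2] at key
  exact key

theorem theorem4 (n : ℕ) (p q : ℝ) (hp : 1 < p) (hpq : 1 / p + 1 / q = 1) :
    (∀ lam α β σ : ℝ, 0 < lam → lam < n → α < n / p → 1 - n / p < β → β < n / q →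
      β + σ - 1 < n / q → (n : ℝ) + 1 = lam + α + β + σ →
      (∀ f : 𝓢(EuclideanSpace ℝ (Fin n), ℂ),
        (∀ᵐ x : EuclideanSpace ℝ (Fin n), ConvolutionExistsAt (powWeight (-lam))
          (fun y => powWeight (-σ) y • f y) x (ContinuousLinearMap.lsmul ℝ ℝ) volume) ∧
        eLpNorm (fun x : EuclideanSpace ℝ (Fin n) => powWeight (-α) x •
            (powWeight (-lam) ⋆[ContinuousLinearMap.lsmul ℝ ℝ, volume]
              (fun y => powWeight (-σ) y • f y)) x) (ENNReal.ofReal p) volume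
          ≤ ENNReal.ofReal (steinWeissGradConst n p q α β σ) *
            eLpNorm (fun x : EuclideanSpace ℝ (Fin n) => powWeight β x * gradNorm f x)
              (ENNReal.ofReal p) volume) ∧
      (∀ g : 𝓢(EuclideanSpace ℝ (Fin n), ℂ),
        eLpNorm (fun x : EuclideanSpace ℝ (Fin n) => powWeight (-α) x • g x)
            (ENNReal.ofReal p) volume
          ≤ ENNReal.ofReal (hardyRellichGradConst n p q α β σ) *
            eLpNorm (fun x : EuclideanSpace ℝ (Fin n) => powWeight β x *
                gradNorm (fun y => powWeight σ y •
                  fracLaplacian ((α + β + σ - 1) / 2) g y) x)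
              (ENNReal.ofReal p) volume)) ∧
    (∀ (γ : ℝ) (m : ℕ), γ + (2 * m + 1) * p < n → -(n * (p - 1)) < γ →
      ∀ u : 𝓢(EuclideanSpace ℝ (Fin n), ℂ),
        ENNReal.ofReal (daviesHinzConst n p q γ m)⁻¹ *
            ∫⁻ x : EuclideanSpace ℝ (Fin n),
              ENNReal.ofReal (powWeight (-γ - (2 * m + 1) * p) x * ‖u x‖ ^ p)
          ≤ ∫⁻ x : EuclideanSpace ℝ (Fin n),
              ENNReal.ofReal (powWeight (-γ) x *
                gradNorm (Laplacian.laplacian^[m] u) x ^ p)) := by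
  refine ⟨fun lam α β σ hlam hlamn hα hβ _ hβσ hsum => ⟨fun f =>
    steinWeiss_gradNorm hp hpq hlam hlamn hα hβ hβσ hsum f, fun g => ?_⟩, fun γ m hγ hγ' u => ?_⟩
  · exact eLpNorm_le_of_lintegral_rpow_le (by linarith)
      (hardyRellich_gradNorm hp hpq hlam hlamn hα hβ hβσ hsum g)
  · obtain ⟨h1, h2, h3⟩ := daviesHinz_exponents hp hpq m hγ hγ'
    have hB : 0 < daviesHinzConst n p q γ m := by
      rw [daviesHinzConst_eq hp hpq m hγ hγ']
      have hm0 : (0 : ℝ) ≤ m := Nat.cast_nonneg m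
      exact Real.rpow_pos_of_pos
        (hardyRellichGradConst_pos h1 h3 (by linarith) (by linarith)) p
    refine (mul_le_mul_right (lintegral_daviesHinz_le hp hpq m hγ hγ' u) _).trans (le_of_eq ?_)
    rw [← mul_assoc, ← ENNReal.ofReal_mul (by positivity), inv_mul_cancel₀ hB.ne',
      ENNReal.ofReal_one, one_mul]
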